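/- Let $q\in\{1,2,3,4\}$, $b\in\mathbb R$ with $|b|<1$, $c_{CFL}>0$, $T\in\mathbb R$ and $K\ge 0$. All functions of $x$ are $2\pi$-periodic, $\|\cdot\|$ is the $L^2(0,2\pi)$ norm, $\hat f_k=\frac1{2\pi}\int_0^{2\pi}f(x)e^{-ikx}\,dx$, $\|f\|_{H^s}^2=2\pi\sum_{k\in\mathbb Z}(1+k^2)^s|\hat f_k|^2$ (with value $\infty$ if $f\notin H^s$), and $\mathcal P_Nf=\sum_{|k|\le N}\hat f_ke^{ikx}$. For $\varepsilon>0$ let $(u,w)$ be a ($2\pi$-periodic, possibly complex-valued) weak solution, with $u(t),w(t)\in L^2(0,2\pi)$ for all $t\ge0$, of $$\partial_tu+\partial_x(bu+w)=0,\qquad \partial_tw+\partial_x\big((1-b^2)u-bw\big)=-\tfrac1\varepsilon w .$$ Put $\beta=\big(\sum_{j=1}^q\frac1j\big)^{-1}$, $\sum_{i=0}^q\alpha_i\zeta^i=\beta\sum_{j=1}^q\frac1j\zeta^{q-j}(\zeta-1)^j$ and $\sum_{i=0}^{q-1}\gamma_i\zeta^i=\beta(\zeta^q-(\zeta-1)^q)$.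 Given $T_0\ge0$, $\Delta t>0$, $t_n=T_0+n\Delta t$ and $N\ge1$, the $q$-th order IMEX-BDF Fourier–Galerkin scheme determines trigonometric polynomials $U_N^n,W_N^n\in\operatorname{span}\{e^{ikx}:|k|\le N\}$, $n\ge0$, by $U_N^i=\mathcal P_Nu(t_i)$, $W_N^i=\mathcal P_Nw(t_i)$ for $0\le i\le q-1$ and, for all $n\ge 0$, $$\sum_{i=0}^q\alpha_iU_N^{n+i}+\Delta t\sum_{i=0}^{q-1}\gamma_i\,\partial_x\big(bU_N^{n+i}+W_N^{n+i}\big)=0,$$ $$\sum_{i=0}^q\alpha_iW_N^{n+i}+\Delta t\sum_{i=0}^{q-1}\gamma_i\,\partial_x\big((1-b^2)U_N^{n+i}-bW_N^{n+i}\big)=-\frac{\beta\Delta t}{\varepsilon}W_N^{n+q}.$$ Assume the CFL condition $\Delta t\le\min\{c_{CFL}/N^2,1\}$, and that one of the following holds: * Case 1: $\|\partial_t^{q+1}u(0)\|_{H^1}+\|\partial_t^{q+1}w(0)\|_{H^1}\le K$ and $\|\partial_t^{q}u(0)\|_{H^2}+\|\partial_t^{q}w(0)\|_{H^2}\le K$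 (and $T_0\ge0$ is arbitrary); * Case 2: $\|u(0)\|_{H^{q+2}}^2+\|w(0)\|_{H^{q+2}}^2\le K$ and $T_0\ge(q+2)\,\varepsilon\log(1/\varepsilon)$. Assume further that $$\|u(T_0)\|_{H^{2q+1}}^2+\|w(T_0)\|_{H^{2q+1}}^2\le K,\qquad \|\partial_tu(T_0)\|_{H^{2q}}^2+\|\partial_tw(T_0)\|_{H^{2q}}^2\le K .$$ Then for every $n\ge 0$ with $t_n\le T$, $$\|u(t_n)-U_N^n\|^2+\|w(t_n)-W_N^n\|^2\le C\Big(\Delta t^{2q}+\frac1{N^{4q}}\Big),$$ where $C>0$ depends only on $q,b,c_{CFL},T,K$; in particular it is independent of $\varepsilon$, $N$ and $\Delta t$ (and of $T_0$ and the solution). -/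

import Mathlib

open scoped ENNReal NNReal ContDiff

noncomputable section

namespace IMEXBDF

/-! ### Functions on the torus `[0, 2π]` -/

/-- `L²` norm over one period, `(∫₀^{2π} |f|² dx)^{1/2}`, with values in `[0, ∞]`. -/
def l2Norm (f : ℝ → ℂ) : ℝ≥0∞ :=
  MeasureTheory.eLpNorm f 2 (MeasureTheory.volume.restrict (Set.Ioc 0 (2 * Real.pi)))

/-- Square integrability over one period. -/
def MemL2 (f : ℝ → ℂ) : Prop :=
  MeasureTheory.MemLp f 2 (MeasureTheory.volume.restrict (Set.Ioc 0 (2 * Real.pi)))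

/-- The Fourier coefficient `(1 / 2π) ∫₀^{2π} f(x) e^{-ikx} dx`. -/
def coeff (f : ℝ → ℂ) (k : ℤ) : ℂ :=
  fourierCoeffOn Real.two_pi_pos f k

/-- The norm of the periodic Sobolev space `H^s` of a periodic distribution, given by its Fourier
coefficients: `(2π ∑ₖ (1 + k²)^s |cₖ|²)^{1/2}`, which is `∞` outside `H^s`. -/
def sobolevNorm (s : ℕ) (c : ℤ → ℂ) : ℝ≥0∞ :=
  (ENNReal.ofReal (2 * Real.pi) *
    ∑' k : ℤ, ENNReal.ofReal ((1 + (k : ℝ) ^ 2) ^ s * ‖c k‖ ^ 2)) ^ (1 / 2 : ℝ)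

/-- The Fourier coefficients of the distribution `∂ₜʳ u(t)`, for `t ≥ 0` (one-sided time
derivatives at `t = 0`). For weak solutions of the system below every coefficient of `u(t)` is a
smooth function of `t ∈ [0, ∞)`, so these derivatives exist. For `r = 0` this is `coeff (u t)`. -/
def timeDerivCoeff (r : ℕ) (u : ℝ → ℝ → ℂ) (t : ℝ) (k : ℤ) : ℂ :=
  iteratedDerivWithin r (fun τ => coeff (u τ) k) (Set.Ici 0) t

/-! ### The hyperbolic relaxation system -/

/-- `(u, w)` is a weak solution, `2π`-periodic in space and with slices in `L²`, of
`∂ₜu + ∂ₓ(bu + w) = 0`, `∂ₜw + ∂ₓ((1 - b²)u - bw) = -w/ε` for times `t ≥ 0`.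
Testing with periodic functions `φ` encodes the periodic boundary condition. -/
structure IsWeakSolution (b ε : ℝ) (u w : ℝ → ℝ → ℂ) : Prop where
  memL2_u : ∀ t, 0 ≤ t → MemL2 (u t)
  memL2_w : ∀ t, 0 ≤ t → MemL2 (w t)
  eq_u : ∀ φ : ℝ → ℂ, ContDiff ℝ ∞ φ → Function.Periodic φ (2 * Real.pi) → ∀ t, 0 ≤ t →
    HasDerivWithinAt (fun τ => ∫ x in (0 : ℝ)..(2 * Real.pi), u τ x * φ x)
      (∫ x in (0 : ℝ)..(2 * Real.pi), ((b : ℂ) * u t x + w t x) * deriv φ x) (Set.Ici 0) t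
  eq_w : ∀ φ : ℝ → ℂ, ContDiff ℝ ∞ φ → Function.Periodic φ (2 * Real.pi) → ∀ t, 0 ≤ t →
    HasDerivWithinAt (fun τ => ∫ x in (0 : ℝ)..(2 * Real.pi), w τ x * φ x)
      ((∫ x in (0 : ℝ)..(2 * Real.pi),
          ((1 - (b : ℂ) ^ 2) * u t x - (b : ℂ) * w t x) * deriv φ x)
        - (1 / (ε : ℂ)) * ∫ x in (0 : ℝ)..(2 * Real.pi), w t x * φ x) (Set.Ici 0) t

/-! ### The Fourier–Galerkin IMEX-BDF scheme -/

/-- `β = 1 / ∑_{j=1}^q 1/j`. -/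
def bdfBeta (q : ℕ) : ℝ := 1 / ∑ j ∈ Finset.Icc 1 q, 1 / (j : ℝ)

/-- `α(ζ) = β ∑_{j=1}^q (1/j) ζ^{q-j} (ζ-1)^j`. -/
def bdfAlphaPoly (q : ℕ) : Polynomial ℝ :=
  Polynomial.C (bdfBeta q) * ∑ j ∈ Finset.Icc 1 q,
    Polynomial.C (1 / (j : ℝ)) * Polynomial.X ^ (q - j) * (Polynomial.X - 1) ^ j

/-- `γ(ζ) = β (ζ^q - (ζ-1)^q)`. -/
def bdfGammaPoly (q : ℕ) : Polynomial ℝ :=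
  Polynomial.C (bdfBeta q) * (Polynomial.X ^ q - (Polynomial.X - 1) ^ q)

/-- The coefficient `αᵢ` of `ζ^i` in `α(ζ)`. -/
def bdfAlpha (q i : ℕ) : ℝ := (bdfAlphaPoly q).coeff i

/-- The coefficient `γᵢ` of `ζ^i` in `γ(ζ)`. -/
def bdfGamma (q i : ℕ) : ℝ := (bdfGammaPoly q).coeff i

/-- `x ↦ e^{ikx}`. -/
def expMode (k : ℤ) (x : ℝ) : ℂ := Complex.exp (Complex.I * (k : ℂ) * (x : ℂ))

/-- Trigonometric polynomials of degree at most `N`: the span of `e^{ikx}`, `-N ≤ k ≤ N`. -/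
def trigPoly (N : ℕ) : Submodule ℂ (ℝ → ℂ) :=
  Submodule.span ℂ (expMode '' Set.Icc (-(N : ℤ)) (N : ℤ))

/-- The projection `P_N f = ∑_{k=-N}^N f̂ₖ e^{ikx}`. -/
def proj (N : ℕ) (f : ℝ → ℂ) (x : ℝ) : ℂ :=
  ∑ k ∈ Finset.Icc (-(N : ℤ)) (N : ℤ), coeff f k * expMode k x

/-- `(U n, W n)`, `n ≥ 0`, is the fully discrete solution of the `q`-th order IMEX-BDF
Fourier–Galerkin scheme with time step `Δt`, started from the projections of `u(tᵢ)` and `w(tᵢ)`,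
where `tᵢ = T₀ + i Δt` and `0 ≤ i ≤ q - 1`. -/
structure IsDiscreteSolution (q N : ℕ) (b ε T₀ Δt : ℝ) (u w : ℝ → ℝ → ℂ)
    (U W : ℕ → ℝ → ℂ) : Prop where
  mem_U : ∀ n, U n ∈ trigPoly N
  mem_W : ∀ n, W n ∈ trigPoly N
  start_U : ∀ i < q, U i = proj N (u (T₀ + i * Δt))
  start_W : ∀ i < q, W i = proj N (w (T₀ + i * Δt))
  step_U : ∀ (n : ℕ) (x : ℝ),
    ∑ i ∈ Finset.range (q + 1), (bdfAlpha q i : ℂ) * U (n + i) x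
      + (Δt : ℂ) * ∑ i ∈ Finset.range q, (bdfGamma q i : ℂ) *
          deriv (fun y => (b : ℂ) * U (n + i) y + W (n + i) y) x = 0
  step_W : ∀ (n : ℕ) (x : ℝ),
    ∑ i ∈ Finset.range (q + 1), (bdfAlpha q i : ℂ) * W (n + i) x
      + (Δt : ℂ) * ∑ i ∈ Finset.range q, (bdfGamma q i : ℂ) *
          deriv (fun y => (1 - (b : ℂ) ^ 2) * U (n + i) y - (b : ℂ) * W (n + i) y) x
      = -((bdfBeta q * Δt / ε : ℝ) : ℂ) * W (n + q) x

/-! ### The two kinds of initial conditions, and the additional regularity -/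

/-- Initial data consistent up to order `q`, with bound `K`; the scheme may be started at any
time `T₀ ≥ 0`. -/
def Case1 (q : ℕ) (K : ℝ≥0) (u w : ℝ → ℝ → ℂ) : Prop :=
  sobolevNorm 1 (timeDerivCoeff (q + 1) u 0) + sobolevNorm 1 (timeDerivCoeff (q + 1) w 0) ≤ K ∧
  sobolevNorm 2 (timeDerivCoeff q u 0) + sobolevNorm 2 (timeDerivCoeff q w 0) ≤ K

/-- Initial data bounded in `H^{q+2}` by `K`, the scheme being started after the initial layer,
at a time `T₀ ≥ (q + 2) ε log (1/ε)`. -/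
def Case2 (q : ℕ) (K : ℝ≥0) (ε T₀ : ℝ) (u w : ℝ → ℝ → ℂ) : Prop :=
  sobolevNorm (q + 2) (coeff (u 0)) ^ 2 + sobolevNorm (q + 2) (coeff (w 0)) ^ 2 ≤ K ∧
  ((q : ℝ) + 2) * ε * Real.log (1 / ε) ≤ T₀

/-- `‖u(T₀)‖²_{H^{2q+1}} + ‖w(T₀)‖²_{H^{2q+1}} ≤ K` and
`‖∂ₜu(T₀)‖²_{H^{2q}} + ‖∂ₜw(T₀)‖²_{H^{2q}} ≤ K`. -/
def ExtraRegularity (q : ℕ) (K : ℝ≥0) (T₀ : ℝ) (u w : ℝ → ℝ → ℂ) : Prop :=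
  sobolevNorm (2 * q + 1) (coeff (u T₀)) ^ 2
    + sobolevNorm (2 * q + 1) (coeff (w T₀)) ^ 2 ≤ K ∧
  sobolevNorm (2 * q) (timeDerivCoeff 1 u T₀) ^ 2
    + sobolevNorm (2 * q) (timeDerivCoeff 1 w T₀) ^ 2 ≤ K

end IMEXBDF

end

namespace IMEXBDF

/-! ### Coefficients of the schemes and multipliers -/

/-! The problem has constant coefficients, so both the system and the scheme decouple into 2×2
problems, one for each Fourier mode `k`. Everything is proved mode by mode, with constants
independent of `k`, `ε`, `N` and `Δt`, and summed at the end by Parseval. Throughout `q = p + 1`, `h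
= Δt`, `κ = k Δt` and, up to the factor `β`, `μ = Δt / ε`.

Stability (`exists_stability`) is the core. The weights `1 - b ^ 2` and `1` symmetrize the transport
matrix. Each equation is tested with the multiplier `x_q - η x_{q-1}` of `exists_multiplier`: the
BDF part then dominates the increment of a positive quadratic form `G` plus a numerical dissipation
`c |x_q - x_{q-1}|²`. The implicit stiff term yields a telescoping contribution that is kept in the
energy, so no constant depends on `μ`. The explicit transport term is a real multiple `θ` of the
multiplier plus a combination of increments. The multiple drops out because the symmetrized
transport is skew-Hermitian. The increments are absorbed by the dissipation at the price of `κ²`,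
and the CFL condition says exactly that `κ² ≲ h`. A discrete Gronwall argument finishes.

Consistency (`exists_mode_consistency`) is Taylor expansion combined with the order conditions. The
relaxation term is evaluated at the new time level, so it creates no extrapolation error, and the
defect involves only `∂ₜ^{q+1}` of the solution and `∂ₓ∂ₜ^q`, never an explicit `1 / ε`.

These derivatives are bounded uniformly in `ε` by `exists_regularity_bound`. Time derivatives of a
solution are again solutions and the symmetrized energy is nonincreasing, so bounds at one time
persist. In Case 1 they hold at time 0. In Case 2 they must be produced at `T₀`: each mode has
characteristic equation `λ² + λ/ε + k² + ikb/ε = 0`. If `1 / ε` is large compared with `1 + |k|`,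
there is a slow root of size `O(|k|)` and a fast root near `-1/ε`, whose component has decayed to
`O(ε^{q+1})` relative to its initial size by time `T₀`. Otherwise `1 / ε ≲ 1 + |k|` and a crude
bound suffices (`exists_layer_bound`).

Modes with `|k| > N` are absent from the numerical solution. They are controlled by the Sobolev norm
at `T₀`, which gives the term `N^{-4q}` (`tail_bound`). -/

theorem bdf_coeffs_one :
    bdfBeta 1 = 1 ∧ bdfAlpha 1 0 = -1 ∧ bdfAlpha 1 1 = 1 ∧
    bdfGamma 1 0 = 1 := by
  have hb : bdfBeta 1 = 1 := by norm_num [bdfBeta, Finset.sum_Icc_succ_top]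
  have ha : bdfAlphaPoly 1 = .C (-1) + .C (1) * .X := by
    apply Polynomial.funext
    intro x
    simp [bdfAlphaPoly, hb]
    ring
  have hg : bdfGammaPoly 1 = .C (1) := by
    apply Polynomial.funext
    intro x
    simp [bdfGammaPoly, hb]
  refine ⟨hb, ?_, ?_, ?_⟩ <;> simp only [bdfAlpha, bdfGamma, ha, hg] <;>
    simp [Polynomial.coeff_X, Polynomial.coeff_one]

theorem bdf_coeffs_two :
    bdfBeta 2 = 2/3 ∧ bdfAlpha 2 0 = 1/3 ∧ bdfAlpha 2 1 = -4/3 ∧ bdfAlpha 2 2 = 1 ∧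
    bdfGamma 2 0 = -2/3 ∧ bdfGamma 2 1 = 4/3 := by
  have hb : bdfBeta 2 = 2/3 := by norm_num [bdfBeta, Finset.sum_Icc_succ_top]
  have ha : bdfAlphaPoly 2 = .C (1/3) + .C (-4/3) * .X + .C (1) * .X ^ 2 := by
    apply Polynomial.funext
    intro x
    simp [bdfAlphaPoly, hb, Finset.sum_Icc_succ_top]
    ring
  have hg : bdfGammaPoly 2 = .C (-2/3) + .C (4/3) * .X := by
    apply Polynomial.funext
    intro x
    simp [bdfGammaPoly, hb]
    ring
  refine ⟨hb, ?_, ?_, ?_, ?_, ?_⟩ <;> simp only [bdfAlpha, bdfGamma, ha, hg] <;>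
    simp [Polynomial.coeff_X, Polynomial.coeff_C]

theorem bdf_coeffs_three :
    bdfBeta 3 = 6/11 ∧ bdfAlpha 3 0 = -2/11 ∧ bdfAlpha 3 1 = 9/11 ∧ bdfAlpha 3 2 = -18/11 ∧
    bdfAlpha 3 3 = 1 ∧
    bdfGamma 3 0 = 6/11 ∧ bdfGamma 3 1 = -18/11 ∧ bdfGamma 3 2 = 18/11 := by
  have hb : bdfBeta 3 = 6/11 := by norm_num [bdfBeta, Finset.sum_Icc_succ_top]
  have ha : bdfAlphaPoly 3 = .C (-2/11) + .C (9/11) * .X + .C (-18/11) * .X ^ 2 + .C (1) * .X ^ 3 := by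
    apply Polynomial.funext
    intro x
    simp [bdfAlphaPoly, hb, Finset.sum_Icc_succ_top]
    ring
  have hg : bdfGammaPoly 3 = .C (6/11) + .C (-18/11) * .X + .C (18/11) * .X ^ 2 := by
    apply Polynomial.funext
    intro x
    simp [bdfGammaPoly, hb]
    ring
  refine ⟨hb, ?_, ?_, ?_, ?_, ?_, ?_, ?_⟩ <;> simp only [bdfAlpha, bdfGamma, ha, hg] <;>
    simp [Polynomial.coeff_X, Polynomial.coeff_C]

theorem bdf_coeffs_four :
    bdfBeta 4 = 12/25 ∧ bdfAlpha 4 0 = 3/25 ∧ bdfAlpha 4 1 = -16/25 ∧ bdfAlpha 4 2 = 36/25 ∧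
    bdfAlpha 4 3 = -48/25 ∧ bdfAlpha 4 4 = 1 ∧
    bdfGamma 4 0 = -12/25 ∧ bdfGamma 4 1 = 48/25 ∧ bdfGamma 4 2 = -72/25 ∧ bdfGamma 4 3 = 48/25 := by
  have hb : bdfBeta 4 = 12/25 := by norm_num [bdfBeta, Finset.sum_Icc_succ_top]
  have ha : bdfAlphaPoly 4 = .C (3/25) + .C (-16/25) * .X + .C (36/25) * .X ^ 2 +
    .C (-48/25) * .X ^ 3 + .C (1) * .X ^ 4 := by
    apply Polynomial.funext
    intro x
    simp [bdfAlphaPoly, hb, Finset.sum_Icc_succ_top]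
    ring
  have hg : bdfGammaPoly 4 = .C (-12/25) + .C (48/25) * .X + .C (-72/25) * .X ^ 2 +
    .C (48/25) * .X ^ 3 := by
    apply Polynomial.funext
    intro x
    simp [bdfGammaPoly, hb]
    ring
  refine ⟨hb, ?_, ?_, ?_, ?_, ?_, ?_, ?_, ?_, ?_⟩ <;> simp only [bdfAlpha, bdfGamma, ha, hg] <;>
    simp [Polynomial.coeff_X, Polynomial.coeff_C]

/-- The order conditions of the backward differentiation formula. -/
theorem bdfAlpha_moment {p : ℕ} (hp : p ≤ 3) {j : ℕ} (hj : j ≤ p + 1) :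
    ∑ i ∈ Finset.range (p + 2), bdfAlpha (p + 1) i * (i : ℝ) ^ j
      = bdfBeta (p + 1) * j * ((p : ℝ) + 1) ^ (j - 1) := by
  interval_cases p
  · obtain ⟨hb, a0, a1, g0⟩ := bdf_coeffs_one
    interval_cases j <;> norm_num [Finset.sum_range_succ, hb, a0, a1]
  · obtain ⟨hb, a0, a1, a2, g0, g1⟩ := bdf_coeffs_two
    interval_cases j <;> norm_num [Finset.sum_range_succ, hb, a0, a1, a2]
  · obtain ⟨hb, a0, a1, a2, a3, g0, g1, g2⟩ := bdf_coeffs_three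
    interval_cases j <;> norm_num [Finset.sum_range_succ, hb, a0, a1, a2, a3]
  · obtain ⟨hb, a0, a1, a2, a3, a4, g0, g1, g2, g3⟩ := bdf_coeffs_four
    interval_cases j <;> norm_num [Finset.sum_range_succ, hb, a0, a1, a2, a3, a4]

/-- The order conditions of the extrapolation. -/
theorem bdfGamma_moment {p : ℕ} (hp : p ≤ 3) {j : ℕ} (hj : j < p + 1) :
    ∑ i ∈ Finset.range (p + 1), bdfGamma (p + 1) i * (i : ℝ) ^ j
      = bdfBeta (p + 1) * ((p : ℝ) + 1) ^ j := by
  interval_cases p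
  · obtain ⟨hb, a0, a1, g0⟩ := bdf_coeffs_one
    interval_cases j
    norm_num [Finset.sum_range_succ, hb, g0]
  · obtain ⟨hb, a0, a1, a2, g0, g1⟩ := bdf_coeffs_two
    interval_cases j <;> norm_num [Finset.sum_range_succ, hb, g0, g1]
  · obtain ⟨hb, a0, a1, a2, a3, g0, g1, g2⟩ := bdf_coeffs_three
    interval_cases j <;> norm_num [Finset.sum_range_succ, hb, g0, g1, g2]
  · obtain ⟨hb, a0, a1, a2, a3, a4, g0, g1, g2, g3⟩ := bdf_coeffs_four
    interval_cases j <;> norm_num [Finset.sum_range_succ, hb, g0, g1, g2, g3]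

theorem bdfAlpha_leading {p : ℕ} (hp : p ≤ 3) : bdfAlpha (p + 1) (p + 1) = 1 := by
  interval_cases p
  · obtain ⟨hb, a0, a1, g0⟩ := bdf_coeffs_one
    exact a1
  · obtain ⟨hb, a0, a1, a2, g0, g1⟩ := bdf_coeffs_two
    exact a2
  · obtain ⟨hb, a0, a1, a2, a3, g0, g1, g2⟩ := bdf_coeffs_three
    exact a3
  · obtain ⟨hb, a0, a1, a2, a3, a4, g0, g1, g2, g3⟩ := bdf_coeffs_four
    exact a4

theorem bdfBeta_pos (p : ℕ) : 0 < bdfBeta (p + 1) := by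
  unfold bdfBeta
  refine one_div_pos.mpr (Finset.sum_pos (fun j hj => ?_) ⟨1, by simp⟩)
  have : 0 < j := (Finset.mem_Icc.mp hj).1
  positivity

/-- `x_{q} - η x_{q-1}` is a multiplier for the backward differentiation formula of order `q`,
with the Lyapunov functional `G` and with control over `x_q - x_{q-1}`. -/
theorem exists_multiplier {p : ℕ} (hp : p ≤ 3) :
    ∃ (η c : ℝ) (G : (ℕ → ℝ) → ℝ), 0 ≤ η ∧ η < 1 ∧ 0 < c ∧
      (∀ x, c * x p ^ 2 ≤ G x) ∧ (∀ x, (∀ i ≤ p, x i = 0) → G x = 0) ∧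
      ∀ x, G (fun i => x (i + 1)) - G x + c * (x (p + 1) - x p) ^ 2
        ≤ (∑ i ∈ Finset.range (p + 2), bdfAlpha (p + 1) i * x i) * (x (p + 1) - η * x p) := by
  -- In each case `G` is written in `x p` and the successive differences. The squares passed to
  -- `linarith` are sum-of-squares certificates obtained by completing squares one variable at a
  -- time. The gap in the last inequality involves differences only, since the terms containing
  -- values telescope. The value `1/50` serves all four orders.
  interval_cases p
  · obtain ⟨hb, a0, a1, g0⟩ := bdf_coeffs_one
    refine ⟨0, 1/50, fun x =>
        (1/2) * x 0 ^ 2,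
      by norm_num, by norm_num, by norm_num, fun x => ?_, fun x hx => ?_, fun x => ?_⟩
    · linarith [sq_nonneg (x 0)]
    · simp [hx 0 (by norm_num)]
    · simp only [Finset.sum_range_succ, Finset.sum_range_zero, a0, a1]
      linarith [sq_nonneg ((x 1 - x 0))]
  · obtain ⟨hb, a0, a1, a2, g0, g1⟩ := bdf_coeffs_two
    refine ⟨1/2, 1/50, fun x =>
        (1/6) * x 1 ^ 2 + (1/6) * x 1 * (x 1 - x 0) + (2/5) * (x 1 - x 0) ^ 2,
      by norm_num, by norm_num, by norm_num, fun x => ?_, fun x hx => ?_, fun x => ?_⟩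
    · linarith [sq_nonneg (x 1 + (25/44) * (x 1 - x 0)), sq_nonneg ((x 1 - x 0))]
    · simp [hx 0 (by norm_num), hx 1 (by norm_num)]
    · simp only [Finset.sum_range_succ, Finset.sum_range_zero, a0, a1, a2]
      linarith [sq_nonneg ((x 1 - x 0) + (-5/12) * (x 2 - x 1)), sq_nonneg ((x 2 - x 1))]
  · obtain ⟨hb, a0, a1, a2, a3, g0, g1, g2⟩ := bdf_coeffs_three
    refine ⟨1/2, 1/50, fun x =>
        (3/22) * x 2 ^ 2 + (-1/11) * x 2 * (x 1 - x 0) + (5/22) * x 2 * (x 2 - x 1) +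
        (1/6) * (x 1 - x 0) ^ 2 + (-1/4) * (x 1 - x 0) * (x 2 - x 1) + (1/2) * (x 2 - x 1) ^ 2,
      by norm_num, by norm_num, by norm_num, fun x => ?_, fun x hx => ?_, fun x => ?_⟩
    · linarith [sq_nonneg (x 2 + (-25/64) * (x 1 - x 0) + (125/128) * (x 2 - x 1)),
      sq_nonneg ((x 1 - x 0) + (-681/1258) * (x 2 - x 1)), sq_nonneg ((x 2 - x 1))]
    · simp [hx 0 (by norm_num), hx 1 (by norm_num), hx 2 (by norm_num)]
    · simp only [Finset.sum_range_succ, Finset.sum_range_zero, a0, a1, a2, a3]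
      linarith [sq_nonneg ((x 1 - x 0) + (-3/4) * (x 2 - x 1) + (6/11) * (x 3 - x 2)),
        sq_nonneg ((x 2 - x 1) + (-84/253) * (x 3 - x 2)), sq_nonneg ((x 3 - x 2))]
  · obtain ⟨hb, a0, a1, a2, a3, a4, g0, g1, g2, g3⟩ := bdf_coeffs_four
    refine ⟨7/10, 1/50, fun x =>
        (9/125) * x 3 ^ 2 + (9/250) * x 3 * (x 1 - x 0) + (-3/25) * x 3 * (x 2 - x 1) +
        (39/250) * x 3 * (x 3 - x 2) + (1/10) * (x 1 - x 0) ^ 2 +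
          (-1/5) * (x 1 - x 0) * (x 2 - x 1) +
        (1/5) * (x 1 - x 0) * (x 3 - x 2) + (2/5) * (x 2 - x 1) ^ 2 +
          (-3/5) * (x 2 - x 1) * (x 3 - x 2) +
        (3/5) * (x 3 - x 2) ^ 2,
      by norm_num, by norm_num, by norm_num, fun x => ?_, fun x hx => ?_, fun x => ?_⟩
    · linarith [sq_nonneg (x 3 + (9/26) * (x 1 - x 0) + (-15/13) * (x 2 - x 1) +
      (3/2) * (x 3 - x 2)), sq_nonneg ((x 1 - x 0) + (-1030/1219) * (x 2 - x 1) +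
        (949/1219) * (x 3 - x 2)), sq_nonneg ((x 2 - x 1) + (-113/201) * (x 3 - x 2)),
          sq_nonneg ((x 3 - x 2))]
    · simp [hx 0 (by norm_num), hx 1 (by norm_num), hx 2 (by norm_num), hx 3 (by norm_num)]
    · simp only [Finset.sum_range_succ, Finset.sum_range_zero, a0, a1, a2, a3, a4]
      linarith [sq_nonneg ((x 1 - x 0) + (-1) * (x 2 - x 1) + (x 3 - x 2) + (-3/5) * (x 4 - x 3)),
        sq_nonneg ((x 2 - x 1) + (-1/2) * (x 3 - x 2) + (41/100) * (x 4 - x 3)),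
          sq_nonneg ((x 3 - x 2) + (1/50) * (x 4 - x 3)), sq_nonneg ((x 4 - x 3))]

/-! ### Complex multiplier and elementary inequalities -/

section

open Finset ComplexConjugate

theorem re_ofReal_sum_mul (s : Finset ℕ) (a : ℕ → ℝ) (z : ℕ → ℂ) (v : ℂ) :
    ((∑ i ∈ s, (a i : ℂ) * z i) * conj v).re
      = (∑ i ∈ s, a i * (z i).re) * v.re + (∑ i ∈ s, a i * (z i).im) * v.im := by
  simp [Complex.mul_re]

/-- The coefficients and `η` are real, so the real part of the product splits into the real
inequality for the real parts plus the one for the imaginary parts. -/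
theorem exists_complex_multiplier {p : ℕ} (hp : p ≤ 3) :
    ∃ (η c : ℝ) (G : (ℕ → ℂ) → ℝ), 0 ≤ η ∧ η < 1 ∧ 0 < c ∧
      (∀ z, c * ‖z p‖ ^ 2 ≤ G z) ∧ (∀ z, (∀ i ≤ p, z i = 0) → G z = 0) ∧
      ∀ z, G (fun i => z (i + 1)) - G z + c * ‖z (p + 1) - z p‖ ^ 2
        ≤ ((∑ i ∈ range (p + 2), (bdfAlpha (p + 1) i : ℂ) * z i)
            * conj (z (p + 1) - η * z p)).re := by
  obtain ⟨η, c, G, h0, h1, hc, hpos, hzero, hstep⟩ := exists_multiplier hp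
  have hn : ∀ z : ℂ, ‖z‖ ^ 2 = z.re ^ 2 + z.im ^ 2 := fun z => by
    rw [Complex.sq_norm, Complex.normSq_apply]; ring
  refine ⟨η, c, fun z => G (fun i => (z i).re) + G (fun i => (z i).im), h0, h1, hc,
    fun z => ?_, fun z hz => ?_, fun z => ?_⟩
  · have h1 := hpos fun i => (z i).re
    have h2 := hpos fun i => (z i).im
    rw [hn, mul_add]
    exact add_le_add h1 h2
  · simp only
    rw [hzero _ fun i hi => by simp [hz i hi], hzero _ fun i hi => by simp [hz i hi], add_zero]
  · have h1 := hstep fun i => (z i).re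
    have h2 := hstep fun i => (z i).im
    rw [hn, re_ofReal_sum_mul]
    simp only [Complex.sub_re, Complex.sub_im, Complex.re_ofReal_mul, Complex.im_ofReal_mul]
    linarith

/-- A combination whose coefficients sum to zero is unchanged when `z 0` is subtracted from every
term, and `z i - z 0` is a sum of increments. This converts extrapolation errors into quantities
that the numerical dissipation can absorb. -/
theorem norm_sum_le_of_sum_eq_zero (m : ℕ) (a : ℕ → ℝ) (ha : ∑ i ∈ range (m + 1), a i = 0)
    (z : ℕ → ℂ) :
    ‖∑ i ∈ range (m + 1), (a i : ℂ) * z i‖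
      ≤ (∑ i ∈ range (m + 1), |a i|) * ∑ j ∈ range m, ‖z (j + 1) - z j‖ := by
  have h : ∑ i ∈ range (m + 1), (a i : ℂ) * z i
      = ∑ i ∈ range (m + 1), (a i : ℂ) * (z i - z 0) := by
    simp only [mul_sub, sum_sub_distrib, ← sum_mul]
    rw [← Complex.ofReal_sum, ha]
    simp
  rw [h, sum_mul]
  refine (norm_sum_le _ _).trans (sum_le_sum fun i hi => ?_)
  rw [norm_mul, Complex.norm_real, Real.norm_eq_abs]
  refine mul_le_mul_of_nonneg_left ?_ (abs_nonneg _)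
  calc ‖z i - z 0‖ = dist (z 0) (z i) := by rw [dist_comm, dist_eq_norm]
    _ ≤ ∑ j ∈ range i, dist (z j) (z (j + 1)) := dist_le_range_sum_dist z i
    _ = ∑ j ∈ range i, ‖z (j + 1) - z j‖ := 
        sum_congr rfl fun j _ => by rw [dist_comm, dist_eq_norm]
    _ ≤ _ := sum_le_sum_of_subset_of_nonneg
        (range_subset_range.2 (by have := mem_range.1 hi; omega)) fun _ _ _ => norm_nonneg _

theorem norm_sum_mul_le (m : ℕ) (a : ℕ → ℝ) (z : ℕ → ℂ) :
    ‖∑ i ∈ range m, (a i : ℂ) * z i‖ ≤ (∑ i ∈ range m, |a i|) * ∑ i ∈ range m, ‖z i‖ := by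
  rw [sum_mul]
  refine (norm_sum_le _ _).trans (sum_le_sum fun i hi => ?_)
  rw [norm_mul, Complex.norm_real, Real.norm_eq_abs]
  exact mul_le_mul_of_nonneg_left
    (single_le_sum (f := fun i => ‖z i‖) (fun _ _ => norm_nonneg _) hi) (abs_nonneg _)

/-- The antisymmetric part of the symmetrized transport term drops out. -/
theorem re_transport_eq (b κ θ : ℝ) (X Y P R : ℂ) :
    ((κ * Complex.I * (b * X + Y)) * conj P * (1 - b ^ 2 : ℝ)
        + (κ * Complex.I * ((1 - (b : ℂ) ^ 2) * X - b * Y)) * conj R).re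
      = (κ * Complex.I * ((1 - b ^ 2 : ℝ) * (b * (X - θ * P) + (Y - θ * R)) * conj P
        + ((1 - (b : ℂ) ^ 2) * (X - θ * P) - b * (Y - θ * R)) * conj R)).re := by
  simp [Complex.mul_re, Complex.mul_im, pow_two]
  ring

/-- Applied to the stiff term: multiplied by `μ`, the lower bound is the increment of `μ (η / 2)
‖d‖²`, which telescopes however large `μ` is. -/
theorem re_mul_conj_sub_ge (η : ℝ) (h0 : 0 ≤ η) (h1 : η < 1) (x y : ℂ) :
    η / 2 * (‖x‖ ^ 2 - ‖y‖ ^ 2) ≤ (x * conj (x - η * y)).re := by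
  have hn : ∀ z : ℂ, ‖z‖ ^ 2 = z.re ^ 2 + z.im ^ 2 := fun z => by
    rw [Complex.sq_norm, Complex.normSq_apply]; ring
  have e : (x * conj (x - η * y)).re
      = x.re ^ 2 + x.im ^ 2 - η * (x.re * y.re + x.im * y.im) := by
    simp [Complex.mul_re]
    ring
  rw [e, hn, hn]
  nlinarith [mul_nonneg h0 (sq_nonneg (x.re - y.re)), mul_nonneg h0 (sq_nonneg (x.im - y.im)),
    mul_nonneg (sub_nonneg.2 h1.le) (sq_nonneg x.re),
    mul_nonneg (sub_nonneg.2 h1.le) (sq_nonneg x.im)]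

theorem sum_shift_le (f : ℕ → ℝ) (hf : ∀ n, 0 ≤ f n) (m p j : ℕ) (hj : j ≤ p) :
    ∑ n ∈ range m, f (n + j) ≤ ∑ n ∈ range (m + p), f n := by
  calc ∑ n ∈ range m, f (n + j) ≤ ∑ n ∈ range (m + j), f n := by
        rw [add_comm m j, sum_range_add]
        simp only [add_comm j]
        exact le_add_of_nonneg_left (sum_nonneg fun _ _ => hf _)
    _ ≤ _ := sum_le_sum_of_subset_of_nonneg (range_subset_range.2 (by omega)) fun _ _ _ => hf _

/-- Each `f n` is counted by at most `p + 1` windows, and the vanishing initial entries allow the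
sum to start at `p`. -/
theorem sum_sum_shift_le (f : ℕ → ℝ) (hf : ∀ n, 0 ≤ f n) (m p : ℕ) (h0 : ∀ n < p, f n = 0) :
    ∑ n ∈ range m, ∑ j ∈ range (p + 1), f (n + j) ≤ (p + 1) * ∑ n ∈ range m, f (n + p) := by
  rw [sum_comm]
  have h : ∑ n ∈ range (m + p), f n = ∑ n ∈ range m, f (n + p) := by
    rw [add_comm m p, sum_range_add, sum_eq_zero fun n hn => h0 n (mem_range.1 hn), zero_add]
    simp only [add_comm p]
  calc _ ≤ ∑ j ∈ range (p + 1), ∑ n ∈ range m, f (n + p) := sum_le_sum fun j hj => by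
        rw [← h]
        exact sum_shift_le f hf m p j (by have := mem_range.1 hj; omega)
    _ = _ := by simp

theorem discrete_gronwall (a : ℕ → ℝ) (x B : ℝ) (hx : 0 ≤ x) (M : ℕ)
    (h : ∀ m ≤ M, a m ≤ x * ∑ n ∈ range m, a n + B) : ∀ m ≤ M, a m ≤ B * (1 + x) ^ m := by
  intro m
  induction m using Nat.strong_induction_on with
  | _ m ih =>
    intro hm
    have h1 : x * ∑ n ∈ range m, a n ≤ x * ∑ n ∈ range m, B * (1 + x) ^ n :=
      mul_le_mul_of_nonneg_left (sum_le_sum fun n hn =>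
        ih n (mem_range.1 hn) ((mem_range.1 hn).le.trans hm)) hx
    have h2 : (∑ n ∈ range m, (1 + x) ^ n) * (1 + x - 1) = (1 + x) ^ m - 1 := geom_sum_mul _ _
    have h3 : x * ∑ n ∈ range m, B * (1 + x) ^ n = B * ((1 + x) ^ m - 1) := by
      rw [← h2, ← mul_sum]
      ring
    linarith [h m hm]

end

/-! ### Extrapolation, perturbation and new-value bounds -/

section

open Finset ComplexConjugate

/-- The extrapolation weights sum to `β` and the multiplier weights to `1 - η`. With `θ = β / (1 -
η)` the difference has weights of sum zero, hence depends on increments only. -/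
theorem exists_extrapolation_bound {p : ℕ} (hp : p ≤ 3) {η : ℝ} (h1 : η < 1) :
    ∃ θ B : ℝ, 0 ≤ B ∧ ∀ z : ℕ → ℂ,
      ‖∑ i ∈ range (p + 1), (bdfGamma (p + 1) i : ℂ) * z i - θ * (z (p + 1) - η * z p)‖
        ≤ B * ∑ j ∈ range (p + 1), ‖z (j + 1) - z j‖ := by
  set θ : ℝ := bdfBeta (p + 1) / (1 - η) with hθ
  let a : ℕ → ℝ := fun i => if i = p + 1 then -θ else if i = p then bdfGamma (p + 1) p + θ * η
    else bdfGamma (p + 1) i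
  have ha : ∀ i < p, a i = bdfGamma (p + 1) i := fun i hi => by
    have h : i ≠ p + 1 := by omega
    simp only [a, if_neg h, if_neg hi.ne]
  have hap : a p = bdfGamma (p + 1) p + θ * η := by simp [a]
  have hap1 : a (p + 1) = -θ := by simp [a]
  have hsum : ∑ i ∈ range (p + 1 + 1), a i = 0 := by
    have hm := bdfGamma_moment hp (j := 0) (by omega)
    simp only [pow_zero, mul_one] at hm
    rw [sum_range_succ] at hm
    rw [sum_range_succ, sum_range_succ, sum_congr rfl fun i hi => ha i (mem_range.1 hi), hap, hap1]
    have : θ * (1 - η) = bdfBeta (p + 1) := div_mul_cancel₀ _ (by linarith)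
    linarith
  refine ⟨θ, ∑ i ∈ range (p + 1 + 1), |a i|, sum_nonneg fun _ _ => abs_nonneg _, fun z => ?_⟩
  convert norm_sum_le_of_sum_eq_zero (p + 1) a hsum z using 2
  rw [sum_range_succ, sum_range_succ, sum_range_succ,
    
    sum_congr rfl fun i hi => by rw [← ha i (mem_range.1 hi)], hap, hap1]
  push_cast
  ring

theorem sq_sum_add_le (m : ℕ) (x y : ℕ → ℝ) :
    (∑ i ∈ range m, (x i + y i)) ^ 2 ≤ 2 * m * ∑ i ∈ range m, (x i ^ 2 + y i ^ 2) := by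
  have h := sq_sum_le_card_mul_sum_sq (s := range m) (f := fun i => x i + y i)
  rw [card_range] at h
  refine h.trans ?_
  rw [mul_comm (2 : ℝ), mul_assoc]
  refine mul_le_mul_of_nonneg_left ?_ (Nat.cast_nonneg _)
  rw [mul_sum]
  exact sum_le_sum fun i _ => by nlinarith [sq_nonneg (x i - y i)]

/-- Young's inequality: the cross term gives `δ S²`, to be absorbed by the dissipation, and a
remainder proportional to `k²`, which `k² ≤ c₁ h` turns into an admissible Gronwall term. Here `S`
stands for the increments, `R` for the old values and `τ` for the defect. -/
theorem perturbation_bound {A B c₁ δ h k S R τ : ℝ} (hA : 0 ≤ A) (hδ : 0 < δ)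
    (hh : 0 < h) (hh1 : h ≤ 1) (hκ : k ^ 2 ≤ c₁ * h) :
    k * (B * S) * (A * (R + τ)) + τ * (A * (R + τ))
      ≤ δ * S ^ 2 + ((A * B) ^ 2 / (2 * δ) * c₁ + 2 * A) * (h * R ^ 2 + τ ^ 2 / h) := by
  have hc : 0 ≤ c₁ := by
    by_contra! hc
    nlinarith [sq_nonneg k]
  have hq : τ ^ 2 ≤ τ ^ 2 / h := by
    rw [le_div_iff₀ hh]
    nlinarith [sq_nonneg τ]
  have hz : 0 ≤ h * R ^ 2 := by positivity
  have hhq : h * τ ^ 2 ≤ τ ^ 2 / h := by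
    have := sq_nonneg τ
    nlinarith
  have h1 : k * (B * S) * (A * (R + τ)) ≤ δ * S ^ 2 + (A * B) ^ 2 / (4 * δ) * (k ^ 2 * (R +
    τ) ^ 2) := by
    have e : δ * S ^ 2 + (A * B) ^ 2 / (4 * δ) * (k ^ 2 * (R + τ) ^ 2)
        - k * (B * S) * (A * (R + τ)) = δ * (S - A * B * k * (R + τ) / (2 * δ)) ^ 2 := by
      field_simp
      ring
    have : 0 ≤ δ * (S - A * B * k * (R + τ) / (2 * δ)) ^ 2 := by positivity
    linarith
  have h2 : k ^ 2 * (R + τ) ^ 2 ≤ 2 * c₁ * (h * R ^ 2 + τ ^ 2 / h) := by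
    calc k ^ 2 * (R + τ) ^ 2 ≤ c₁ * h * (2 * (R ^ 2 + τ ^ 2)) :=
          mul_le_mul hκ (by nlinarith [sq_nonneg (R - τ)]) (sq_nonneg _) (by positivity)
      _ = 2 * c₁ * (h * R ^ 2 + h * τ ^ 2) := by ring
      _ ≤ _ := by gcongr
  have h3 : τ * (R + τ) ≤ 2 * (h * R ^ 2 + τ ^ 2 / h) := by
    have : τ * R ≤ h * R ^ 2 + τ ^ 2 / h := by
      have e : h * R ^ 2 + τ ^ 2 / h - τ * R = h * (R - τ / (2 * h)) ^ 2 + 3 / 4 * (τ ^ 2 / h) := by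
        field_simp
        ring
      have : 0 ≤ h * (R - τ / (2 * h)) ^ 2 + 3 / 4 * (τ ^ 2 / h) := by positivity
      linarith
    nlinarith
  calc _ ≤ δ * S ^ 2 + (A * B) ^ 2 / (4 * δ) * (2 * c₁ * (h * R ^ 2 + τ ^ 2 / h))
        + A * (2 * (h * R ^ 2 + τ ^ 2 / h)) := by
        refine add_le_add (h1.trans (by gcongr)) ?_
        rw [mul_left_comm]
        gcongr
    _ = _ := by
        field_simp
        ring

/-- The new values are controlled by the old ones, uniformly in the stiffness `μ`. -/
theorem exists_next_bound {p : ℕ} (hp : p ≤ 3) {c₁ : ℝ} (hc₁ : 0 ≤ c₁) :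
    ∃ A : ℝ, 0 ≤ A ∧ ∀ (κ τ : ℝ) (e f d : ℕ → ℂ), |κ| ≤ c₁ →
      ∀ a' b' : ℂ, ‖a'‖ ≤ 1 → ‖b'‖ ≤ 1 → ∀ μ : ℝ, 0 ≤ μ →
      (∀ i, ‖e i‖ ≤ ‖f i‖ + ‖d i‖) →
      ‖∑ i ∈ range (p + 2), (bdfAlpha (p + 1) i : ℂ) * e i
        + κ * Complex.I * (a' * ∑ i ∈ range (p + 1), (bdfGamma (p + 1) i : ℂ) * f i
          + b' * ∑ i ∈ range (p + 1), (bdfGamma (p + 1) i : ℂ) * d i) + (μ : ℂ) * e (p + 1)‖ ≤ τ →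
      ‖e (p + 1)‖ ≤ A * ∑ i ∈ range (p + 1), (‖f i‖ + ‖d i‖) + τ := by
  refine ⟨∑ i ∈ range (p + 1), |bdfAlpha (p + 1) i|
    + c₁ * ∑ i ∈ range (p + 1), |bdfGamma (p + 1) i|, by positivity, ?_⟩
  intro κ τ e f d hκ a' b' ha' hb' μ hμ hefd hτ
  set g := ∑ i ∈ range (p + 1), |bdfGamma (p + 1) i|
  have hg : 0 ≤ g := by positivity
  have h1 := norm_sum_mul_le (p + 1) (bdfAlpha (p + 1)) e
  have h2 := norm_sum_mul_le (p + 1) (bdfGamma (p + 1)) f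
  have h3 := norm_sum_mul_le (p + 1) (bdfGamma (p + 1)) d
  set X := ∑ i ∈ range (p + 1), (bdfGamma (p + 1) i : ℂ) * f i
  set Y := ∑ i ∈ range (p + 1), (bdfGamma (p + 1) i : ℂ) * d i
  have h4 : ‖κ * Complex.I * (a' * X + b' * Y)‖
      ≤ c₁ * (g * ∑ i ∈ range (p + 1), (‖f i‖ + ‖d i‖)) := by
    rw [norm_mul, norm_mul, Complex.norm_I, Complex.norm_real, Real.norm_eq_abs, mul_one]
    refine mul_le_mul hκ ?_ (norm_nonneg _) hc₁
    rw [sum_add_distrib, mul_add]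
    refine (norm_add_le _ _).trans (add_le_add ?_ ?_)
    · rw [norm_mul]
      exact (mul_le_of_le_one_left (norm_nonneg _) ha').trans h2
    · rw [norm_mul]
      exact (mul_le_of_le_one_left (norm_nonneg _) hb').trans h3
  -- The leading BDF coefficient is 1, so the new value carries the total factor `1 + μ ≥ 1`:
  -- stiffness only helps.
  have h5 : ‖e (p + 1)‖ ≤ ‖((1 + μ : ℝ) : ℂ) * e (p + 1)‖ := by
    rw [norm_mul, Complex.norm_real, Real.norm_of_nonneg (by positivity)]
    exact le_mul_of_one_le_left (norm_nonneg _) (by linarith)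
  have h6 : ((1 + μ : ℝ) : ℂ) * e (p + 1)
      = (∑ i ∈ range (p + 2), (bdfAlpha (p + 1) i : ℂ) * e i
        + κ * Complex.I * (a' * X + b' * Y) + (μ : ℂ) * e (p + 1))
        - κ * Complex.I * (a' * X + b' * Y)
        - ∑ i ∈ range (p + 1), (bdfAlpha (p + 1) i : ℂ) * e i := by
    rw [sum_range_succ _ (p + 1), bdfAlpha_leading hp]
    push_cast
    ring
  rw [h6] at h5
  have h7 : ∑ i ∈ range (p + 1), ‖e i‖ ≤ ∑ i ∈ range (p + 1), (‖f i‖ + ‖d i‖) :=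
    sum_le_sum fun i _ => hefd i
  have h8 := mul_le_mul_of_nonneg_left h7
    (sum_nonneg fun i (_ : i ∈ range (p + 1)) => abs_nonneg (bdfAlpha (p + 1) i))
  have h9 := (norm_sub_le (∑ i ∈ range (p + 2), (bdfAlpha (p + 1) i : ℂ) * e i
        + κ * Complex.I * (a' * X + b' * Y) + (μ : ℂ) * e (p + 1)
        - κ * Complex.I * (a' * X + b' * Y)) (∑ i ∈ range (p + 1), (bdfAlpha (p + 1) i : ℂ) * e i))
  have h10 := norm_sub_le (∑ i ∈ range (p + 2), (bdfAlpha (p + 1) i : ℂ) * e i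
        + κ * Complex.I * (a' * X + b' * Y) + (μ : ℂ) * e (p + 1))
        (κ * Complex.I * (a' * X + b' * Y))
  linarith

end

/-! ### Energy inequality for one step -/

section

open Finset ComplexConjugate

/-- One step of the scheme, for a single Fourier mode: `κ = k Δt`, `h = Δt`, `μ = Δt / ε`. -/
theorem exists_energy_step {p : ℕ} (hp : p ≤ 3) {b c₁ : ℝ} (hb : |b| < 1) (hc₁ : 0 ≤ c₁) :
    ∃ (c C : ℝ) (E : ℝ → (ℕ → ℂ) → (ℕ → ℂ) → ℝ), 0 < c ∧ 0 < C ∧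
      (∀ μ, 0 ≤ μ → ∀ e d, c * (‖e p‖ ^ 2 + ‖d p‖ ^ 2) ≤ E μ e d) ∧
      (∀ μ e d, (∀ i ≤ p, e i = 0) → (∀ i ≤ p, d i = 0) → E μ e d = 0) ∧
      ∀ (h κ μ τ : ℝ) (e d : ℕ → ℂ), 0 < h → h ≤ 1 → |κ| ≤ c₁ → κ ^ 2 ≤ c₁ * h → 0 ≤ μ →
        ‖∑ i ∈ range (p + 2), (bdfAlpha (p + 1) i : ℂ) * e i
          + κ * Complex.I * (b * ∑ i ∈ range (p + 1), (bdfGamma (p + 1) i : ℂ) * e i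
            + ∑ i ∈ range (p + 1), (bdfGamma (p + 1) i : ℂ) * d i)‖ ≤ τ →
        ‖∑ i ∈ range (p + 2), (bdfAlpha (p + 1) i : ℂ) * d i
          + κ * Complex.I * ((1 - (b : ℂ) ^ 2) * ∑ i ∈ range (p + 1), (bdfGamma (p + 1) i : ℂ) * e i
            - b * ∑ i ∈ range (p + 1), (bdfGamma (p + 1) i : ℂ) * d i)
          + (μ : ℂ) * d (p + 1)‖ ≤ τ →
        E μ (fun i => e (i + 1)) (fun i => d (i + 1)) - E μ e d
            + c * (‖e (p + 1) - e p‖ ^ 2 + ‖d (p + 1) - d p‖ ^ 2)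
          ≤ c / (2 * (p + 1)) * ∑ j ∈ range (p + 1), (‖e (j + 1) - e j‖ ^ 2 + ‖d (j + 1) - d j‖ ^ 2)
            + C * (h * ∑ i ∈ range (p + 1), (‖e i‖ ^ 2 + ‖d i‖ ^ 2) + τ ^ 2 / h) := by
  obtain ⟨η, c, G, hη0, hη1, hc, hGpos, hGzero, hGstep⟩ := exists_complex_multiplier hp
  obtain ⟨θ, B, hB, hextra⟩ := exists_extrapolation_bound hp hη1
  obtain ⟨A, hA, hnext⟩ := exists_next_bound hp hc₁
  have hb2 : b ^ 2 < 1 := (sq_lt_one_iff_abs_lt_one b).2 hb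
  have hs : 0 < 1 - b ^ 2 := by linarith
  have hs1 : 1 - b ^ 2 ≤ 1 := by nlinarith [sq_nonneg b]
  set c' := c * (1 - b ^ 2) with hc'
  have hc'pos : 0 < c' := mul_pos hc hs
  have hc'c : c' ≤ c := mul_le_of_le_one_right hc.le hs1
  -- Since `S²` is at most `2 (p + 1)` times the sum of squared increments, this choice gives the
  -- coefficient `c' / (2 (p + 1))` of the conclusion.
  set δ := c' / (4 * ((p : ℝ) + 1) ^ 2) with hδ
  have hδpos : 0 < δ := by positivity
  set A' := 2 * A + 2 with hA'
  set C₀ := (A' * (2 * B)) ^ 2 / (2 * δ) * c₁ + 2 * A' with hC₀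
  have hC₀pos : 0 < C₀ := by positivity
  -- The energy is the symmetrized multiplier form plus the telescoping part of the stiff term. The
  -- factor `2 (p + 1)` comes from Cauchy–Schwarz for `R²`.
  refine ⟨c', C₀ * (2 * (p + 1)), fun μ e d => (1 - b ^ 2) * G e + G d + μ * (η / 2) * ‖d p‖ ^ 2,
    hc'pos, by positivity, fun μ hμ e d => ?_, fun μ e d he hd => ?_, ?_⟩
  · have h1 := mul_le_mul_of_nonneg_left (hGpos e) hs.le
    have h2 := (mul_le_mul_of_nonneg_right hc'c (sq_nonneg ‖d p‖)).trans (hGpos d)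
    have h3 : 0 ≤ μ * (η / 2) * ‖d p‖ ^ 2 := by positivity
    rw [hc'] at h2 ⊢
    linarith
  · simp [hGzero e he, hGzero d hd, hd p le_rfl]
  intro h κ μ τ e d hh hh1 hκ hκ2 hμ hu hw
  have hτ : 0 ≤ τ := (norm_nonneg _).trans hu
  -- The multipliers contain the new values. Bounding these by the old ones leaves only indices up
  -- to `p` in the Gronwall term, so no smallness of `h` is needed later.
  have hnu := hnext κ τ e e d hκ b 1 (by simpa using hb.le) (by simp) 0 le_rfl
    (fun i => le_add_of_nonneg_right (norm_nonneg _)) (by simpa using hu)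
  have hnw := hnext κ τ d e d hκ ((1 - b ^ 2 : ℝ) : ℂ) ((-b : ℝ) : ℂ)
    (by rw [Complex.norm_real, Real.norm_of_nonneg hs.le]; exact hs1)
    (by rw [Complex.norm_real, norm_neg]; exact hb.le) μ hμ
    (fun i => le_add_of_nonneg_left (norm_nonneg _))
    (by convert hw using 5; push_cast; ring)
  have hxi := hextra e
  have hups := hextra d
  have hge := hGstep e
  have hgd := hGstep d
  have hmu := re_mul_conj_sub_ge η hη0 hη1 (d (p + 1)) (d p)
  set P := e (p + 1) - η * e p with hP
  set Q := d (p + 1) - η * d p with hQ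
  set X := ∑ i ∈ range (p + 1), (bdfGamma (p + 1) i : ℂ) * e i
  set Y := ∑ i ∈ range (p + 1), (bdfGamma (p + 1) i : ℂ) * d i
  set Ae := ∑ i ∈ range (p + 2), (bdfAlpha (p + 1) i : ℂ) * e i
  set Ad := ∑ i ∈ range (p + 2), (bdfAlpha (p + 1) i : ℂ) * d i
  set R := ∑ i ∈ range (p + 1), (‖e i‖ + ‖d i‖) with hR
  set S := ∑ j ∈ range (p + 1), (‖e (j + 1) - e j‖ + ‖d (j + 1) - d j‖) with hS
  have hR0 : 0 ≤ R := by positivity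
  have hlast : ‖e p‖ + ‖d p‖ ≤ R :=
    single_le_sum (f := fun i => ‖e i‖ + ‖d i‖) (fun _ _ => by positivity) (self_mem_range_succ p)
  have hPQ : ‖P‖ + ‖Q‖ ≤ A' * (R + τ) := by
    have h1 : ∀ z : ℂ, ‖(η : ℂ) * z‖ ≤ ‖z‖ := fun z => by
      rw [norm_mul, Complex.norm_real, Real.norm_of_nonneg hη0]
      exact mul_le_of_le_one_left (norm_nonneg _) hη1.le
    have h2 := (norm_sub_le (e (p + 1)) (η * e p)).trans (add_le_add le_rfl (h1 _))
    have h3 := (norm_sub_le (d (p + 1)) (η * d p)).trans (add_le_add le_rfl (h1 _))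
    have h4 : 0 ≤ A * τ := mul_nonneg hA hτ
    rw [hA']
    linarith
  have hXY : ‖X - θ * P‖ + ‖Y - θ * Q‖ ≤ B * S := by
    rw [hS, sum_add_distrib, mul_add]
    exact add_le_add hxi hups
  set Tu := Ae + κ * Complex.I * (b * X + Y) with hTu
  set Tw := Ad + κ * Complex.I * ((1 - (b : ℂ) ^ 2) * X - b * Y) + (μ : ℂ) * d (p + 1) with hTw
  -- The BDF and stiff products are expressed through the defects `Tu`, `Tw` and the transport term.
  -- In the latter `X` and `Y` may be replaced by `X - θ P` and `Y - θ Q`, which are combinations of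
  -- increments.
  have hident : (1 - b ^ 2) * (Ae * conj P).re + (Ad * conj Q).re + μ * (d (p + 1) * conj Q).re
      = (1 - b ^ 2) * (Tu * conj P).re + (Tw * conj Q).re
        - (κ * Complex.I * ((1 - b ^ 2 : ℝ) * (b * (X - θ * P) + (Y - θ * Q)) * conj P
        + ((1 - (b : ℂ) ^ 2) * (X - θ * P) - b * (Y - θ * Q)) * conj Q)).re := by
    rw [← re_transport_eq, Complex.add_re, Complex.re_mul_ofReal, hTu, hTw, add_mul Ae,
      add_mul (Ad + _), add_mul Ad, Complex.add_re, Complex.add_re, Complex.add_re,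
      mul_assoc (μ : ℂ), Complex.re_ofReal_mul]
    ring
  have hcross : -(κ * Complex.I * ((1 - b ^ 2 : ℝ) * (b * (X - θ * P) + (Y - θ * Q)) * conj P
        + ((1 - (b : ℂ) ^ 2) * (X - θ * P) - b * (Y - θ * Q)) * conj Q)).re
      ≤ |κ| * (2 * B * S) * (A' * (R + τ)) := by
    refine (neg_le_abs _).trans ((Complex.abs_re_le_norm _).trans ?_)
    have hbz : ∀ z : ℂ, ‖(b : ℂ) * z‖ ≤ ‖z‖ := fun z => by
      rw [norm_mul, Complex.norm_real]
      exact mul_le_of_le_one_left (norm_nonneg _) hb.le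
    have hsz : ∀ z : ℂ, ‖((1 - b ^ 2 : ℝ) : ℂ) * z‖ ≤ ‖z‖ := fun z => by
      rw [norm_mul, Complex.norm_real, Real.norm_of_nonneg hs.le]
      exact mul_le_of_le_one_left (norm_nonneg _) hs1
    have e1 : ‖(1 - b ^ 2 : ℝ) * (b * (X - θ * P) + (Y - θ * Q)) * conj P‖ ≤ B * S * ‖P‖ := by
      rw [norm_mul, Complex.norm_conj]
      refine mul_le_mul_of_nonneg_right ((hsz _).trans ((norm_add_le _ _).trans ?_)) (norm_nonneg _)
      exact (add_le_add (hbz _) le_rfl).trans hXY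
    have e2 : ‖((1 - (b : ℂ) ^ 2) * (X - θ * P) - b * (Y - θ * Q)) * conj Q‖ ≤ B * S * ‖Q‖ := by
      rw [norm_mul, Complex.norm_conj]
      refine mul_le_mul_of_nonneg_right ((norm_sub_le _ _).trans ?_) (norm_nonneg _)
      refine (add_le_add ?_ (hbz _)).trans hXY
      have hcast : 1 - (b : ℂ) ^ 2 = ((1 - b ^ 2 : ℝ) : ℂ) := by push_cast; rfl
      rw [hcast]
      exact hsz _
    have hBS : 0 ≤ B * S := mul_nonneg hB (by positivity)
    rw [norm_mul, norm_mul, Complex.norm_I, Complex.norm_real, Real.norm_eq_abs, mul_one,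
      mul_assoc |κ|]
    refine mul_le_mul_of_nonneg_left ((norm_add_le _ _).trans ?_) (abs_nonneg _)
    calc _ ≤ B * S * (‖P‖ + ‖Q‖) := by linarith
      _ ≤ B * S * (A' * (R + τ)) := mul_le_mul_of_nonneg_left hPQ hBS
      _ ≤ _ := by
        have : 0 ≤ B * S * (A' * (R + τ)) := by positivity
        linarith
  have hforce : (1 - b ^ 2) * (Tu * conj P).re + (Tw * conj Q).re ≤ τ * (A' * (R + τ)) := by
    have e1 : ∀ z w : ℂ, ‖z‖ ≤ τ → (z * conj w).re ≤ τ * ‖w‖ := fun z w hz => by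
      refine (Complex.re_le_norm _).trans ?_
      rw [norm_mul, Complex.norm_conj]
      exact mul_le_mul_of_nonneg_right hz (norm_nonneg _)
    have e2 : (1 - b ^ 2) * (Tu * conj P).re ≤ τ * ‖P‖ :=
      (mul_le_mul_of_nonneg_left (e1 Tu P hu) hs.le).trans
        (mul_le_of_le_one_left (by positivity) hs1)
    have e3 := e1 Tw Q hw
    have e4 := mul_le_mul_of_nonneg_left hPQ hτ
    linarith
  have hpert := perturbation_bound (A := A') (B := 2 * B) (c₁ := c₁) (δ := δ) (h := h) (k := |κ|)
    (S := S) (R := R) (τ := τ) (by positivity) hδpos hh hh1 (by rwa [sq_abs])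
  have hS2 : S ^ 2 ≤ 2 * (p + 1) * ∑ j ∈ range (p + 1),
      (‖e (j + 1) - e j‖ ^ 2 + ‖d (j + 1) - d j‖ ^ 2) := by
    simpa using sq_sum_add_le (p + 1) (fun j => ‖e (j + 1) - e j‖) (fun j => ‖d (j + 1) - d j‖)
  have hR2 : R ^ 2 ≤ 2 * (p + 1) * ∑ i ∈ range (p + 1), (‖e i‖ ^ 2 + ‖d i‖ ^ 2) := by
    simpa using sq_sum_add_le (p + 1) (fun i => ‖e i‖) (fun i => ‖d i‖)
  set DD := ∑ j ∈ range (p + 1), (‖e (j + 1) - e j‖ ^ 2 + ‖d (j + 1) - d j‖ ^ 2)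
  set RR := ∑ i ∈ range (p + 1), (‖e i‖ ^ 2 + ‖d i‖ ^ 2)
  have f1 : δ * S ^ 2 ≤ c' / (2 * (p + 1)) * DD := by
    refine (mul_le_mul_of_nonneg_left hS2 hδpos.le).trans (le_of_eq ?_)
    rw [hδ]
    field_simp
    ring
  have f2 : C₀ * (h * R ^ 2 + τ ^ 2 / h) ≤ C₀ * (2 * (p + 1)) * (h * RR + τ ^ 2 / h) := by
    rw [mul_assoc]
    refine mul_le_mul_of_nonneg_left ?_ hC₀pos.le
    have g1 := mul_le_mul_of_nonneg_left hR2 hh.le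
    have g2 : τ ^ 2 / h ≤ 2 * (p + 1) * (τ ^ 2 / h) :=
      le_mul_of_one_le_left (by positivity) (by have : (0 : ℝ) ≤ p := Nat.cast_nonneg p; linarith)
    linarith
  have f3 := mul_le_mul_of_nonneg_left hge hs.le
  have f4 := mul_le_mul_of_nonneg_right hc'c (sq_nonneg ‖d (p + 1) - d p‖)
  have f5 := mul_le_mul_of_nonneg_left hmu hμ
  have f6 : c' * ‖e (p + 1) - e p‖ ^ 2 = (1 - b ^ 2) * (c * ‖e (p + 1) - e p‖ ^ 2) := by
    rw [hc']
    ring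
  simp only
  rw [← hC₀] at hpert
  linarith

end

/-! ### Summation over time and stability -/

section

open Finset

/-- On summing over `n`, every squared increment occurs in at most `p + 1` windows, so the
coefficient `c / (2 (p + 1))` uses up only half of the dissipation. The `m` terms `τ² / h` add up to
elapsed time times `τ² / h²`. -/
theorem energy_sum_le (p : ℕ) {c C h τ : ℝ} (hc : 0 < c) (hC : 0 < C) (hh : 0 < h)
    (E a D : ℕ → ℝ) (ha : ∀ n, 0 ≤ a n) (hD : ∀ n, 0 ≤ D n) (ha0 : ∀ n < p, a n = 0)
    (hD0 : ∀ n < p, D n = 0) (hE0 : E 0 = 0) (hE : ∀ n, c * a (n + p) ≤ E n)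
    (hstep : ∀ n, E (n + 1) - E n + c * D (n + p)
      ≤ c / (2 * (p + 1)) * ∑ j ∈ range (p + 1), D (n + j)
        + C * (h * ∑ j ∈ range (p + 1), a (n + j) + τ ^ 2 / h)) (m : ℕ) :
    a (m + p) ≤ C * (p + 1) / c * h * ∑ n ∈ range m, a (n + p)
      + C / c * (m * h) * (τ ^ 2 / h ^ 2) := by
  have h1 : ∑ n ∈ range m, (E (n + 1) - E n + c * D (n + p)) ≤ _ :=
    sum_le_sum fun n (_ : n ∈ range m) => hstep n
  rw [sum_add_distrib, sum_range_sub, hE0, ← mul_sum, sum_add_distrib, ← mul_sum, ← mul_sum,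
    sum_add_distrib, ← mul_sum, sum_const, card_range, nsmul_eq_mul] at h1
  have h2 := sum_sum_shift_le D hD m p hD0
  have h3 := sum_sum_shift_le a ha m p ha0
  have h4 : c / (2 * (p + 1)) * ∑ n ∈ range m, ∑ j ∈ range (p + 1), D (n + j)
      ≤ c / 2 * ∑ n ∈ range m, D (n + p) := by
    refine (mul_le_mul_of_nonneg_left h2 (by positivity)).trans (le_of_eq ?_)
    field_simp
  have h5 : C * (h * ∑ n ∈ range m, ∑ j ∈ range (p + 1), a (n + j))
      ≤ C * (h * ((p + 1) * ∑ n ∈ range m, a (n + p))) := by gcongr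
  have h6 : 0 ≤ c * ∑ n ∈ range m, D (n + p) :=
    mul_nonneg hc.le (sum_nonneg fun _ _ => hD _)
  have h7 := hE m
  have h8 : c * a (m + p) ≤ C * (h * ((p + 1) * ∑ n ∈ range m, a (n + p))) +
    C * (m * (τ ^ 2 / h)) := by
    linarith
  have e : C * (p + 1) / c * h * ∑ n ∈ range m, a (n + p) + C / c * (m * h) * (τ ^ 2 / h ^ 2)
      = (C * (h * ((p + 1) * ∑ n ∈ range m, a (n + p))) + C * (m * (τ ^ 2 / h))) / c := by
    field_simp
  rw [e, le_div_iff₀ hc]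
  linarith

/-- Stability of the scheme for a single Fourier mode, uniformly in the stiffness `μ`. -/
theorem exists_stability {p : ℕ} (hp : p ≤ 3) {b c₁ : ℝ} (hb : |b| < 1) (hc₁ : 0 ≤ c₁) (T : ℝ) :
    ∃ C : ℝ, 0 < C ∧ ∀ (h κ μ τ : ℝ) (e d : ℕ → ℂ), 0 < h → h ≤ 1 → |κ| ≤ c₁ → κ ^ 2 ≤ c₁ * h →
      0 ≤ μ → (∀ i ≤ p, e i = 0) → (∀ i ≤ p, d i = 0) →
      (∀ n, ‖∑ i ∈ range (p + 2), (bdfAlpha (p + 1) i : ℂ) * e (n + i)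
          + κ * Complex.I * (b * ∑ i ∈ range (p + 1), (bdfGamma (p + 1) i : ℂ) * e (n + i)
            + ∑ i ∈ range (p + 1), (bdfGamma (p + 1) i : ℂ) * d (n + i))‖ ≤ τ) →
      (∀ n, ‖∑ i ∈ range (p + 2), (bdfAlpha (p + 1) i : ℂ) * d (n + i)
          + κ * Complex.I *
            ((1 - (b : ℂ) ^ 2) * ∑ i ∈ range (p + 1), (bdfGamma (p + 1) i : ℂ) * e (n + i)
              - b * ∑ i ∈ range (p + 1), (bdfGamma (p + 1) i : ℂ) * d (n + i))
          + (μ : ℂ) * d (n + (p + 1))‖ ≤ τ) →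
      ∀ m : ℕ, m * h ≤ T → ‖e m‖ ^ 2 + ‖d m‖ ^ 2 ≤ C * (τ ^ 2 / h ^ 2) := by
  obtain ⟨c, C, E, hc, hC, hEpos, hEzero, hstep⟩ := exists_energy_step hp hb hc₁
  set C' := C * (p + 1) / c with hC'
  have hC'pos : 0 < C' := by positivity
  refine ⟨(C / c * |T| + 1) * Real.exp (C' * |T|), by positivity, ?_⟩
  intro h κ μ τ e d hh hh1 hκ hκ2 hμ he hd hu hw m hm
  set a : ℕ → ℝ := fun n => ‖e n‖ ^ 2 + ‖d n‖ ^ 2 with ha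
  have hq : 0 ≤ τ ^ 2 / h ^ 2 := by positivity
  have ha0 : ∀ n ≤ p, a n = 0 := fun n hn => by simp [ha, he n hn, hd n hn]
  rcases le_total m p with hmp | hmp
  · rw [show ‖e m‖ ^ 2 + ‖d m‖ ^ 2 = 0 from ha0 m hmp]
    positivity
  -- The window starting at `m'` controls its last old entry, with index `m' + p`.
  obtain ⟨m', rfl⟩ : ∃ m', m = m' + p := ⟨m - p, by omega⟩
  have hm' : (m' : ℝ) * h ≤ |T| := by
    push_cast at hm
    have : (0 : ℝ) ≤ p * h := by positivity
    linarith [le_abs_self T]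
  set D : ℕ → ℝ := fun n => ‖e (n + 1) - e n‖ ^ 2 + ‖d (n + 1) - d n‖ ^ 2 with hD
  have hEstep : ∀ n, E μ (fun i => e (n + 1 + i)) (fun i => d (n + 1 + i))
        - E μ (fun i => e (n + i)) (fun i => d (n + i)) + c * D (n + p)
      ≤ c / (2 * (p + 1)) * ∑ j ∈ range (p + 1), D (n + j)
        + C * (h * ∑ j ∈ range (p + 1), a (n + j) + τ ^ 2 / h) := fun n => by
    have e1 : ∀ f : ℕ → ℂ, (fun i => f (n + 1 + i)) = fun i => f (n + (i + 1)) := fun f =>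
      funext fun i => by rw [add_assoc, add_comm 1]
    rw [e1, e1]
    exact hstep h κ μ τ (fun i => e (n + i)) (fun i => d (n + i)) hh hh1 hκ hκ2 hμ (hu n) (hw n)
  have key := energy_sum_le p hc hC hh (τ := τ)
    (fun n => E μ (fun i => e (n + i)) fun i => d (n + i)) a D
    (fun n => by simp only [ha]; positivity) (fun n => by simp only [hD]; positivity)
    (fun n hn => ha0 n hn.le)
    (fun n hn => by simp [hD, he n hn.le, hd n hn.le, he (n + 1) hn, hd (n + 1) hn])
    (hEzero μ _ _ (fun i hi => by rw [zero_add]; exact he i hi)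
      (fun i hi => by rw [zero_add]; exact hd i hi))
    (fun n => hEpos μ hμ (fun i => e (n + i)) fun i => d (n + i)) hEstep
  clear hEstep hstep hu hw
  have hgr := discrete_gronwall (fun n => a (n + p)) (C' * h) (C / c * |T| * (τ ^ 2 / h ^ 2))
    (by positivity) m' (fun n hn => by
      refine (key n).trans (add_le_add le_rfl ?_)
      have : (n : ℝ) * h ≤ |T| := by
        refine le_trans ?_ hm'
        gcongr
      gcongr) m' le_rfl
  refine hgr.trans ?_
  have hexp : (1 + C' * h) ^ m' ≤ Real.exp (C' * |T|) := by
    calc (1 + C' * h) ^ m' ≤ Real.exp (C' * h) ^ m' := by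
          gcongr
          linarith [Real.add_one_le_exp (C' * h)]
      _ = Real.exp (C' * (m' * h)) := by rw [← Real.exp_nat_mul]; ring_nf
      _ ≤ _ := by gcongr
  calc _ ≤ C / c * |T| * (τ ^ 2 / h ^ 2) * Real.exp (C' * |T|) := by gcongr
    _ ≤ (C / c * |T| + 1) * (τ ^ 2 / h ^ 2) * Real.exp (C' * |T|) := by
      gcongr
      linarith
    _ = _ := by ring

end

section

open Finset ComplexConjugate

/-! ### Taylor expansion and consistency -/

/-- `f (j + 1)` is the derivative of `f j` on `[0, ∞)`. -/
def IsDerivSeq (f : ℕ → ℝ → ℂ) : Prop :=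
  ∀ j t, 0 ≤ t → HasDerivWithinAt (f j) (f (j + 1) t) (Set.Ici 0) t

theorem IsDerivSeq.shift {f : ℕ → ℝ → ℂ} (hf : IsDerivSeq f) : IsDerivSeq fun j => f (j + 1) :=
  fun j t ht => hf (j + 1) t ht

theorem IsDerivSeq.hasDerivWithinAt_comp_add {f : ℕ → ℝ → ℂ} (hf : IsDerivSeq f) (j : ℕ) {a s : ℝ}
    (ha : 0 ≤ a) (hs : 0 ≤ s) :
    HasDerivWithinAt (fun σ => f j (a + σ)) (f (j + 1) (a + s)) (Set.Ici 0) s := by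
  have h := (hf j (a + s) (by positivity)).scomp s
    (((hasDerivAt_id s).const_add a).hasDerivWithinAt (s := Set.Ici 0))
    (fun x (hx : 0 ≤ x) => Set.mem_Ici.2 (add_nonneg ha hx))
  rw [one_smul] at h
  exact h

/-- Induction on `r`: the derivative of the remainder in `s` is the remainder of lower order for the
shifted sequence, and the mean value inequality gains a factor `s`. The factorial in the remainder
is not needed. -/
theorem IsDerivSeq.taylor {f : ℕ → ℝ → ℂ} (hf : IsDerivSeq f) (r : ℕ) {a B : ℝ} (ha : 0 ≤ a)
    (hB : ∀ t, a ≤ t → ‖f r t‖ ≤ B) {s : ℝ} (hs : 0 ≤ s) :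
    ‖f 0 (a + s) - ∑ j ∈ range r, ((s ^ j / j.factorial : ℝ) : ℂ) * f j a‖ ≤ B * s ^ r := by
  induction r generalizing f s with
  | zero => simpa using hB (a + s) (by linarith)
  | succ r ih =>
    have hB0 : 0 ≤ B := (norm_nonneg _).trans (hB a le_rfl)
    have hd : ∀ x ∈ Set.Icc 0 s, HasDerivWithinAt
        (fun σ => f 0 (a + σ) - ∑ j ∈ range (r + 1), ((σ ^ j / j.factorial : ℝ) : ℂ) * f j a)
        (f 1 (a + x) - ∑ j ∈ range r, ((x ^ j / j.factorial : ℝ) : ℂ) * f (j + 1) a)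
        (Set.Icc 0 s) x := by
      intro x hx
      refine ((hf.hasDerivWithinAt_comp_add 0 ha hx.1).mono Set.Icc_subset_Ici_self).sub ?_
      simp only [sum_range_succ' _ r, pow_zero, Nat.factorial_zero, Nat.cast_one, div_one,
        Complex.ofReal_one, one_mul]
      refine HasDerivWithinAt.add_const _ (HasDerivWithinAt.fun_sum fun j _ => ?_)
      refine HasDerivWithinAt.mul_const ?_ _
      have h := ((hasDerivAt_pow (j + 1) x).div_const ((j + 1).factorial : ℝ)).ofReal_comp
      refine HasDerivAt.hasDerivWithinAt ?_
      have e : x ^ j / j.factorial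
          = ((j + 1 : ℕ) * x ^ (j + 1 - 1)) / ((j + 1).factorial : ℝ) := by
        rw [Nat.factorial_succ, Nat.add_sub_cancel]
        push_cast
        have : (j.factorial : ℝ) ≠ 0 := by positivity
        field_simp
      rw [e]
      exact h
    have hbound : ∀ x ∈ Set.Icc 0 s,
        ‖f 1 (a + x) - ∑ j ∈ range r, ((x ^ j / j.factorial : ℝ) : ℂ) * f (j + 1) a‖
          ≤ B * s ^ r := fun x hx => by
      refine (ih hf.shift hB hx.1).trans ?_
      have := hx.1
      have := hx.2
      gcongr
    have h := (convex_Icc (0 : ℝ) s).norm_image_sub_le_of_norm_hasDerivWithin_le hd hbound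
      (Set.left_mem_Icc.2 hs) (Set.right_mem_Icc.2 hs)
    have h0 : f 0 (a + 0) - ∑ j ∈ range (r + 1), (((0 : ℝ) ^ j / j.factorial : ℝ) : ℂ) * f j a
        = 0 := by
      simp [sum_range_succ']
    rw [h0, sub_zero, sub_zero, Real.norm_of_nonneg hs] at h
    rw [pow_succ, ← mul_assoc]
    exact h

/-- Both terms are expanded at `a`. The moment conditions up to degree `p + 1` make the Taylor
polynomials agree, so only remainders survive. -/
theorem exists_alpha_consistency {p : ℕ} (hp : p ≤ 3) :
    ∃ C : ℝ, 0 ≤ C ∧ ∀ (f : ℕ → ℝ → ℂ), IsDerivSeq f → ∀ a B h : ℝ, 0 ≤ a → 0 < h →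
      (∀ t, a ≤ t → ‖f (p + 2) t‖ ≤ B) →
      ‖∑ i ∈ range (p + 2), (bdfAlpha (p + 1) i : ℂ) * f 0 (a + i * h)
        - (h * bdfBeta (p + 1) : ℝ) * f 1 (a + (p + 1) * h)‖ ≤ C * (h ^ (p + 2) * B) := by
  refine ⟨∑ i ∈ range (p + 2), |bdfAlpha (p + 1) i| * (i : ℝ) ^ (p + 2)
    + bdfBeta (p + 1) * ((p : ℝ) + 1) ^ (p + 1), ?_, ?_⟩
  · have := bdfBeta_pos p
    positivity
  intro f hf a B h ha hh hB
  have hβ := bdfBeta_pos p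
  have e1 : ∀ i : ℕ, ‖(bdfAlpha (p + 1) i : ℂ) * f 0 (a + i * h) - (bdfAlpha (p + 1) i : ℂ)
      * ∑ j ∈ range (p + 2), (((i * h) ^ j / j.factorial : ℝ) : ℂ) * f j a‖
      ≤ |bdfAlpha (p + 1) i| * (i : ℝ) ^ (p + 2) * (h ^ (p + 2) * B) := fun i => by
    rw [← mul_sub, norm_mul, Complex.norm_real, Real.norm_eq_abs, mul_assoc]
    refine mul_le_mul_of_nonneg_left ?_ (abs_nonneg _)
    have := hf.taylor (p + 2) ha hB (s := i * h) (by positivity)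
    rwa [mul_comm B, mul_pow, mul_assoc] at this
  have e2 : ‖(h * bdfBeta (p + 1) : ℝ) * f 1 (a + (p + 1) * h) - ((h * bdfBeta (p + 1) : ℝ) : ℂ)
      * ∑ j ∈ range (p + 1), (((((p : ℝ) + 1) * h) ^ j / j.factorial : ℝ) : ℂ) * f (j + 1) a‖
      ≤ bdfBeta (p + 1) * ((p : ℝ) + 1) ^ (p + 1) * (h ^ (p + 2) * B) := by
    rw [← mul_sub, norm_mul, Complex.norm_real, Real.norm_of_nonneg (by positivity)]
    have := hf.shift.taylor (p + 1) ha hB (s := (p + 1) * h) (by positivity)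
    calc _ ≤ h * bdfBeta (p + 1) * (B * ((p + 1) * h) ^ (p + 1)) :=
          mul_le_mul_of_nonneg_left this (by positivity)
      _ = _ := by rw [mul_pow]; ring
  have e3 : ∑ i ∈ range (p + 2), (bdfAlpha (p + 1) i : ℂ)
        * ∑ j ∈ range (p + 2), (((i * h) ^ j / j.factorial : ℝ) : ℂ) * f j a
      = ((h * bdfBeta (p + 1) : ℝ) : ℂ)
      * ∑ j ∈ range (p + 1), (((((p : ℝ) + 1) * h) ^ j / j.factorial : ℝ) : ℂ) * f (j + 1) a := by
    have g1 : ∀ j ∈ range (p + 2), ∑ i ∈ range (p + 2), (bdfAlpha (p + 1) i : ℂ)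
        * ((((i * h) ^ j / j.factorial : ℝ) : ℂ) * f j a)
        = ((h ^ j / j.factorial * (bdfBeta (p + 1) * j * ((p : ℝ) + 1) ^ (j - 1)) : ℝ) : ℂ)
          * f j a := fun j hj => by
      rw [← bdfAlpha_moment hp (by have := mem_range.1 hj; omega), mul_sum, Complex.ofReal_sum,
        sum_mul]
      refine sum_congr rfl fun i _ => ?_
      push_cast
      ring
    simp only [mul_sum]
    rw [sum_comm, sum_congr rfl g1, sum_range_succ']
    simp only [Nat.cast_zero, mul_zero, zero_mul, Complex.ofReal_zero, add_zero,
      Nat.add_sub_cancel]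
    refine sum_congr rfl fun j _ => ?_
    have e : h ^ (j + 1) / ((j + 1).factorial : ℝ)
          * (bdfBeta (p + 1) * (j + 1 : ℕ) * ((p : ℝ) + 1) ^ j)
        = h * bdfBeta (p + 1) * ((((p : ℝ) + 1) * h) ^ j / j.factorial) := by
      rw [Nat.factorial_succ, mul_pow]
      push_cast
      have : (j.factorial : ℝ) ≠ 0 := by positivity
      field_simp
      ring
    rw [e, Complex.ofReal_mul (h * bdfBeta (p + 1)), mul_assoc]
  calc _ = ‖∑ i ∈ range (p + 2), ((bdfAlpha (p + 1) i : ℂ) * f 0 (a + i * h)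
        - (bdfAlpha (p + 1) i : ℂ)
          * ∑ j ∈ range (p + 2), (((i * h) ^ j / j.factorial : ℝ) : ℂ) * f j a)
        - ((h * bdfBeta (p + 1) : ℝ) * f 1 (a + (p + 1) * h) - ((h * bdfBeta (p + 1) : ℝ) : ℂ)
      * ∑ j ∈ range (p + 1), (((((p : ℝ) + 1) * h) ^ j / j.factorial : ℝ) : ℂ) * f (j + 1) a)‖ := by
        rw [sum_sub_distrib, e3]
        congr 1
        ring
    _ ≤ _ := by
        rw [add_mul (Finset.sum _ _), sum_mul]
        refine (norm_sub_le _ _).trans (add_le_add ?_ e2)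
        exact (norm_sum_le _ _).trans (sum_le_sum fun i _ => e1 i)

theorem exists_gamma_consistency {p : ℕ} (hp : p ≤ 3) :
    ∃ C : ℝ, 0 ≤ C ∧ ∀ (f : ℕ → ℝ → ℂ), IsDerivSeq f → ∀ a B h : ℝ, 0 ≤ a → 0 < h →
      (∀ t, a ≤ t → ‖f (p + 1) t‖ ≤ B) →
      ‖∑ i ∈ range (p + 1), (bdfGamma (p + 1) i : ℂ) * f 0 (a + i * h)
        - bdfBeta (p + 1) * f 0 (a + (p + 1) * h)‖ ≤ C * (h ^ (p + 1) * B) := by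
  refine ⟨∑ i ∈ range (p + 1), |bdfGamma (p + 1) i| * (i : ℝ) ^ (p + 1)
    + bdfBeta (p + 1) * ((p : ℝ) + 1) ^ (p + 1), ?_, ?_⟩
  · have := bdfBeta_pos p
    positivity
  intro f hf a B h ha hh hB
  have hβ := bdfBeta_pos p
  have e1 : ∀ i : ℕ, ‖(bdfGamma (p + 1) i : ℂ) * f 0 (a + i * h) - (bdfGamma (p + 1) i : ℂ)
      * ∑ j ∈ range (p + 1), (((i * h) ^ j / j.factorial : ℝ) : ℂ) * f j a‖
      ≤ |bdfGamma (p + 1) i| * (i : ℝ) ^ (p + 1) * (h ^ (p + 1) * B) := fun i => by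
    rw [← mul_sub, norm_mul, Complex.norm_real, Real.norm_eq_abs, mul_assoc]
    refine mul_le_mul_of_nonneg_left ?_ (abs_nonneg _)
    have := hf.taylor (p + 1) ha hB (s := i * h) (by positivity)
    rwa [mul_comm B, mul_pow, mul_assoc] at this
  have e2 : ‖bdfBeta (p + 1) * f 0 (a + (p + 1) * h) - (bdfBeta (p + 1) : ℂ)
      * ∑ j ∈ range (p + 1), (((((p : ℝ) + 1) * h) ^ j / j.factorial : ℝ) : ℂ) * f j a‖
      ≤ bdfBeta (p + 1) * ((p : ℝ) + 1) ^ (p + 1) * (h ^ (p + 1) * B) := by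
    rw [← mul_sub, norm_mul, Complex.norm_real, Real.norm_of_nonneg hβ.le]
    have := hf.taylor (p + 1) ha hB (s := (p + 1) * h) (by positivity)
    calc _ ≤ bdfBeta (p + 1) * (B * ((p + 1) * h) ^ (p + 1)) :=
          mul_le_mul_of_nonneg_left this hβ.le
      _ = _ := by rw [mul_pow]; ring
  have e3 : ∑ i ∈ range (p + 1), (bdfGamma (p + 1) i : ℂ)
        * ∑ j ∈ range (p + 1), (((i * h) ^ j / j.factorial : ℝ) : ℂ) * f j a
      = (bdfBeta (p + 1) : ℂ)
      * ∑ j ∈ range (p + 1), (((((p : ℝ) + 1) * h) ^ j / j.factorial : ℝ) : ℂ) * f j a := by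
    simp only [mul_sum]
    rw [sum_comm]
    refine sum_congr rfl fun j hj => ?_
    have := bdfGamma_moment hp (mem_range.1 hj)
    rw [← mul_assoc, ← Complex.ofReal_mul, mul_pow, mul_div_assoc, ← mul_assoc, ← this, sum_mul,
      Complex.ofReal_sum, sum_mul]
    refine sum_congr rfl fun i _ => ?_
    push_cast
    ring
  calc _ = ‖∑ i ∈ range (p + 1), ((bdfGamma (p + 1) i : ℂ) * f 0 (a + i * h)
        - (bdfGamma (p + 1) i : ℂ)
          * ∑ j ∈ range (p + 1), (((i * h) ^ j / j.factorial : ℝ) : ℂ) * f j a)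
        - (bdfBeta (p + 1) * f 0 (a + (p + 1) * h) - (bdfBeta (p + 1) : ℂ)
      * ∑ j ∈ range (p + 1), (((((p : ℝ) + 1) * h) ^ j / j.factorial : ℝ) : ℂ) * f j a)‖ := by
        rw [sum_sub_distrib, e3]
        congr 1
        ring
    _ ≤ _ := by
        rw [add_mul (Finset.sum _ _), sum_mul]
        refine (norm_sub_le _ _).trans (add_le_add ?_ e2)
        exact (norm_sum_le _ _).trans (sum_le_sum fun i _ => e1 i)

end

section

open Finset ComplexConjugate

/-! ### The Fourier modes of the relaxation system -/

/-- The right hand side of the relaxation system for the Fourier mode `k`. -/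
noncomputable def modeRhs (b ε : ℝ) (k : ℤ) (v : (ℝ → ℂ) × (ℝ → ℂ)) : (ℝ → ℂ) × (ℝ → ℂ) :=
  (fun t => -(Complex.I * k) * (b * v.1 t + v.2 t),
    fun t => -(Complex.I * k) * ((1 - (b : ℂ) ^ 2) * v.1 t - b * v.2 t) - 1 / (ε : ℂ) * v.2 t)

/-- Solutions of the relaxation system for the Fourier mode `k`. -/
def IsMode (b ε : ℝ) (k : ℤ) (v : (ℝ → ℂ) × (ℝ → ℂ)) : Prop :=
  ∀ t, 0 ≤ t → HasDerivWithinAt v.1 ((modeRhs b ε k v).1 t) (Set.Ici 0) t ∧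
    HasDerivWithinAt v.2 ((modeRhs b ε k v).2 t) (Set.Ici 0) t

theorem IsMode.modeRhs {b ε : ℝ} {k : ℤ} {v : (ℝ → ℂ) × (ℝ → ℂ)} (hv : IsMode b ε k v) :
    IsMode b ε k (modeRhs b ε k v) := fun t ht =>
  ⟨(((hv t ht).1.const_mul (b : ℂ)).add (hv t ht).2).const_mul _,
    ((((hv t ht).1.const_mul (1 - (b : ℂ) ^ 2)).sub ((hv t ht).2.const_mul (b : ℂ))).const_mul
      _).sub ((hv t ht).2.const_mul _)⟩

/-- The time derivatives of a solution. -/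
noncomputable def modeDeriv (b ε : ℝ) (k : ℤ) (v : (ℝ → ℂ) × (ℝ → ℂ)) (r : ℕ) :
    (ℝ → ℂ) × (ℝ → ℂ) := (modeRhs b ε k)^[r] v

theorem modeDeriv_succ (b ε : ℝ) (k : ℤ) (v : (ℝ → ℂ) × (ℝ → ℂ)) (r : ℕ) :
    modeDeriv b ε k v (r + 1) = modeRhs b ε k (modeDeriv b ε k v r) :=
  Function.iterate_succ_apply' _ _ _

theorem IsMode.modeDeriv {b ε : ℝ} {k : ℤ} {v : (ℝ → ℂ) × (ℝ → ℂ)} (hv : IsMode b ε k v) (r : ℕ) :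
    IsMode b ε k (modeDeriv b ε k v r) := by
  induction r with
  | zero => exact hv
  | succ r ih =>
    rw [modeDeriv_succ]
    exact ih.modeRhs

theorem IsMode.isDerivSeq_fst {b ε : ℝ} {k : ℤ} {v : (ℝ → ℂ) × (ℝ → ℂ)} (hv : IsMode b ε k v) :
    IsDerivSeq fun j => (IMEXBDF.modeDeriv b ε k v j).1 := fun j t ht => by
  simp only [modeDeriv_succ]
  exact (hv.modeDeriv j t ht).1

theorem IsMode.isDerivSeq_snd {b ε : ℝ} {k : ℤ} {v : (ℝ → ℂ) × (ℝ → ℂ)} (hv : IsMode b ε k v) :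
    IsDerivSeq fun j => (IMEXBDF.modeDeriv b ε k v j).2 := fun j t ht => by
  simp only [modeDeriv_succ]
  exact (hv.modeDeriv j t ht).2

theorem IsDerivSeq.iteratedDerivWithin_eq {f : ℕ → ℝ → ℂ} (hf : IsDerivSeq f) (r : ℕ) {t : ℝ}
    (ht : 0 ≤ t) : iteratedDerivWithin r (f 0) (Set.Ici 0) t = f r t := by
  induction r generalizing t with
  | zero => simp
  | succ r ih =>
    have e : Set.EqOn (iteratedDerivWithin r (f 0) (Set.Ici 0)) (f r) (Set.Ici 0) :=
      fun s hs => ih hs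
    rw [iteratedDerivWithin_succ, derivWithin_congr e (ih ht)]
    exact (hf r t ht).derivWithin (uniqueDiffOn_Ici 0 t ht)

/-- The symmetrizer makes the energy of a mode nonincreasing. -/
theorem IsMode.energy_antitone {b ε : ℝ} (hε : 0 < ε) {k : ℤ}
    {v : (ℝ → ℂ) × (ℝ → ℂ)} (hv : IsMode b ε k v) :
    AntitoneOn (fun t => (1 - b ^ 2) * ‖v.1 t‖ ^ 2 + ‖v.2 t‖ ^ 2) (Set.Ici 0) := by
  have hn : ∀ f : ℝ → ℂ, ∀ f' t, HasDerivWithinAt f f' (Set.Ici 0) t →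
      HasDerivWithinAt (fun s => ‖f s‖ ^ 2) (2 * (f' * conj (f t)).re) (Set.Ici 0) t := by
    intro f f' t h
    have := h.norm_sq
    rwa [Complex.inner] at this
  have hd : ∀ t, 0 ≤ t → HasDerivWithinAt (fun t => (1 - b ^ 2) * ‖v.1 t‖ ^ 2 + ‖v.2 t‖ ^ 2)
      (-(2 / ε * ‖v.2 t‖ ^ 2)) (Set.Ici 0) t := by
    intro t ht
    have h := ((hn _ _ t (hv t ht).1).const_mul (1 - b ^ 2)).add (hn _ _ t (hv t ht).2)
    refine h.congr_deriv ?_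
    rw [Complex.sq_norm, Complex.normSq_apply]
    simp [IMEXBDF.modeRhs, Complex.mul_re, Complex.mul_im, pow_two, ← Complex.ofReal_inv]
    ring
  refine antitoneOn_of_deriv_nonpos (convex_Ici 0)
    (fun t ht => (hd t ht).continuousWithinAt) ?_ ?_
  · rw [interior_Ici]
    intro t ht
    exact ((hd t (le_of_lt ht)).hasDerivAt (Ici_mem_nhds ht)).differentiableAt.differentiableWithinAt
  · rw [interior_Ici]
    intro t ht
    rw [((hd t (le_of_lt ht)).hasDerivAt (Ici_mem_nhds ht)).deriv]
    have : 0 ≤ 2 / ε * ‖v.2 t‖ ^ 2 := by positivity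
    linarith

theorem IsMode.norm_sq_le {b ε : ℝ} (hb : |b| < 1) (hε : 0 < ε) {k : ℤ}
    {v : (ℝ → ℂ) × (ℝ → ℂ)} (hv : IsMode b ε k v) {s t : ℝ} (hs : 0 ≤ s) (hst : s ≤ t) :
    ‖v.1 t‖ ^ 2 + ‖v.2 t‖ ^ 2 ≤ 1 / (1 - b ^ 2) * (‖v.1 s‖ ^ 2 + ‖v.2 s‖ ^ 2) := by
  have hs' : 0 < 1 - b ^ 2 := by linarith [(sq_lt_one_iff_abs_lt_one b).2 hb]
  have h : (1 - b ^ 2) * ‖v.1 t‖ ^ 2 + ‖v.2 t‖ ^ 2 ≤ (1 - b ^ 2) * ‖v.1 s‖ ^ 2 + ‖v.2 s‖ ^ 2 :=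
    hv.energy_antitone hε hs (hs.trans hst) hst
  rw [one_div, ← div_eq_inv_mul, le_div_iff₀ hs']
  have h1 : 0 ≤ b ^ 2 * ‖v.2 t‖ ^ 2 := by positivity
  have h2 : 0 ≤ b ^ 2 * ‖v.1 s‖ ^ 2 := by positivity
  linarith

/-- Consistency of the scheme for a mode. -/
theorem exists_mode_consistency {p : ℕ} (hp : p ≤ 3) {b : ℝ} (hb : |b| < 1) :
    ∃ C : ℝ, 0 ≤ C ∧ ∀ (ε : ℝ) (k : ℤ) (v : (ℝ → ℂ) × (ℝ → ℂ)), IsMode b ε k v →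
      ∀ a B h : ℝ, 0 ≤ a → 0 < h →
      (∀ t, a ≤ t → ‖(modeDeriv b ε k v (p + 2)).1 t‖ ≤ B) →
      (∀ t, a ≤ t → ‖(modeDeriv b ε k v (p + 2)).2 t‖ ≤ B) →
      (∀ t, a ≤ t → |(k : ℝ)| * ‖(modeDeriv b ε k v (p + 1)).1 t‖ ≤ B) →
      (∀ t, a ≤ t → |(k : ℝ)| * ‖(modeDeriv b ε k v (p + 1)).2 t‖ ≤ B) →
      ‖∑ i ∈ range (p + 2), (bdfAlpha (p + 1) i : ℂ) * v.1 (a + i * h)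
          + (h * k : ℝ) * Complex.I *
            (b * ∑ i ∈ range (p + 1), (bdfGamma (p + 1) i : ℂ) * v.1 (a + i * h)
            + ∑ i ∈ range (p + 1), (bdfGamma (p + 1) i : ℂ) * v.2 (a + i * h))‖
        ≤ C * (h ^ (p + 2) * B) ∧
      ‖∑ i ∈ range (p + 2), (bdfAlpha (p + 1) i : ℂ) * v.2 (a + i * h)
          + (h * k : ℝ) * Complex.I *
            ((1 - (b : ℂ) ^ 2) * ∑ i ∈ range (p + 1), (bdfGamma (p + 1) i : ℂ) * v.1 (a + i * h)
              - b * ∑ i ∈ range (p + 1), (bdfGamma (p + 1) i : ℂ) * v.2 (a + i * h))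
          + (bdfBeta (p + 1) * h / ε : ℝ) * v.2 (a + (p + 1) * h)‖ ≤ C * (h ^ (p + 2) * B) := by
  obtain ⟨A, hA, hα⟩ := exists_alpha_consistency hp
  obtain ⟨Γ, hΓ, hγ⟩ := exists_gamma_consistency hp
  have hs : 0 < 1 - b ^ 2 := by linarith [(sq_lt_one_iff_abs_lt_one b).2 hb]
  have hs1 : 1 - b ^ 2 ≤ 1 := by nlinarith [sq_nonneg b]
  refine ⟨A + 2 * Γ, by positivity, fun ε k v hv a B h ha hh h1 h2 h3 h4 => ?_⟩
  have hB : 0 ≤ B := (norm_nonneg _).trans (h1 a le_rfl)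
  have hf := hv.isDerivSeq_fst
  have hg := hv.isDerivSeq_snd
  have au := hα _ hf a B h ha hh h1
  have aw := hα _ hg a B h ha hh h2
  -- The transport term of the first equation equals `∂ₜu`, so its extrapolation error is bounded by
  -- `∂ₜ^{p+2}u`.
  have gu := hγ _ hf.shift a B h ha hh h1
  -- In the second equation only the transport part of `∂ₜw` is extrapolated, so that `w / ε` stays
  -- out of the error. The price is a factor `|k|` on the derivatives of order `p + 1`.
  have hφ : IsDerivSeq fun j t => -(Complex.I * k) * ((1 - (b : ℂ) ^ 2) * (modeDeriv b ε k v j).1 t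
      - b * (modeDeriv b ε k v j).2 t) := fun j t ht =>
    (((hf j t ht).const_mul (1 - (b : ℂ) ^ 2)).sub ((hg j t ht).const_mul (b : ℂ))).const_mul _
  have gw := hγ _ hφ a (2 * B) h ha hh fun t ht => by
    rw [norm_mul, norm_neg, norm_mul, Complex.norm_I, one_mul, Complex.norm_intCast]
    have e1 : ‖(1 - (b : ℂ) ^ 2) * (modeDeriv b ε k v (p + 1)).1 t‖
        ≤ ‖(modeDeriv b ε k v (p + 1)).1 t‖ := by
      have hcast : 1 - (b : ℂ) ^ 2 = ((1 - b ^ 2 : ℝ) : ℂ) := by push_cast; rfl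
      rw [hcast, norm_mul, Complex.norm_real, Real.norm_of_nonneg hs.le]
      exact mul_le_of_le_one_left (norm_nonneg _) hs1
    have e2 : ‖(b : ℂ) * (modeDeriv b ε k v (p + 1)).2 t‖
        ≤ ‖(modeDeriv b ε k v (p + 1)).2 t‖ := by
      rw [norm_mul, Complex.norm_real]
      exact mul_le_of_le_one_left (norm_nonneg _) hb.le
    have e3 := mul_le_mul_of_nonneg_left ((norm_sub_le _ _).trans (add_le_add e1 e2))
      (abs_nonneg (k : ℝ))
    linarith [h3 t ht, h4 t ht]
  have hsmul : ∀ (z : ℂ) (D : ℝ), ‖z‖ ≤ Γ * (h ^ (p + 1) * D) →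
      ‖(h : ℂ) * z‖ ≤ Γ * (h ^ (p + 2) * D) := fun z D hz => by
    rw [norm_mul, Complex.norm_real, Real.norm_of_nonneg hh.le]
    calc _ ≤ h * (Γ * (h ^ (p + 1) * D)) := mul_le_mul_of_nonneg_left hz hh.le
      _ = _ := by ring
  have gu' := hsmul _ _ gu
  have gw' := hsmul _ _ gw
  have hpow : 0 ≤ Γ * (h ^ (p + 2) * B) := by positivity
  simp only [modeDeriv, Function.iterate_zero, id, zero_add,
    Function.iterate_one] at au aw gu' gw'
  simp only [modeRhs] at au aw gu' gw'
  constructor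
  · have h5 := (norm_sub_le _ _).trans (add_le_add au gu')
    refine le_trans (le_of_eq ?_) (h5.trans (by linarith))
    congr 1
    have e : ∑ i ∈ range (p + 1), (bdfGamma (p + 1) i : ℂ)
          * (-(Complex.I * k) * (b * v.1 (a + i * h) + v.2 (a + i * h)))
        = -(Complex.I * k) * (b * ∑ i ∈ range (p + 1), (bdfGamma (p + 1) i : ℂ) * v.1 (a + i * h)
            + ∑ i ∈ range (p + 1), (bdfGamma (p + 1) i : ℂ) * v.2 (a + i * h)) := by
      simp only [mul_sum, mul_add, sum_add_distrib]
      congr 1 <;> exact sum_congr rfl fun i _ => by ring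
    rw [e]
    push_cast
    ring
  · have h5 := (norm_sub_le _ _).trans (add_le_add aw gw')
    refine le_trans (le_of_eq ?_) (h5.trans (by linarith))
    congr 1
    have e : ∑ i ∈ range (p + 1), (bdfGamma (p + 1) i : ℂ)
          * (-(Complex.I * k) * ((1 - (b : ℂ) ^ 2) * v.1 (a + i * h) - b * v.2 (a + i * h)))
        = -(Complex.I * k) * ((1 - (b : ℂ) ^ 2)
            * ∑ i ∈ range (p + 1), (bdfGamma (p + 1) i : ℂ) * v.1 (a + i * h)
            - b * ∑ i ∈ range (p + 1), (bdfGamma (p + 1) i : ℂ) * v.2 (a + i * h)) := by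
      simp only [mul_sum, mul_sub, sum_sub_distrib]
      congr 1 <;> exact sum_congr rfl fun i _ => by ring
    rw [e]
    push_cast
    ring

end

section

open Finset ComplexConjugate

/-! ### The initial layer -/

theorem eq_exp_mul_of_hasDerivWithinAt {f : ℝ → ℂ} {l : ℂ}
    (hf : ∀ t, 0 ≤ t → HasDerivWithinAt f (l * f t) (Set.Ici 0) t) {t : ℝ} (ht : 0 ≤ t) :
    f t = Complex.exp (l * t) * f 0 := by
  have hd : ∀ x ∈ Set.Ici (0 : ℝ),
      HasDerivWithinAt (fun s : ℝ => Complex.exp (-l * s) * f s) 0 (Set.Ici 0) x := by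
    intro x hx
    have h1 : HasDerivAt (fun s : ℝ => Complex.exp (-l * s)) (Complex.exp (-l * x) * (-l)) x := by
      have h := ((Complex.ofRealCLM.hasDerivAt (x := x)).const_mul (-l)).cexp
      simpa using h
    refine (h1.hasDerivWithinAt.mul (hf x hx)).congr_deriv ?_
    ring
  have h := (convex_Ici (0 : ℝ)).norm_image_sub_le_of_norm_hasDerivWithin_le (C := 0) hd
    (fun x _ => by simp) (Set.mem_Ici.2 le_rfl) (Set.mem_Ici.2 ht)
  rw [zero_mul, norm_le_zero_iff, sub_eq_zero] at h
  simp only [Complex.ofReal_zero, mul_zero, Complex.exp_zero, one_mul] at h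
  rw [← h, ← mul_assoc, ← Complex.exp_add]
  simp

theorem exists_roots (s m : ℂ) : ∃ x y : ℂ, x + y = s ∧ x * y = m ∧ ‖x‖ ≤ ‖y‖ := by
  obtain ⟨d, hd⟩ := IsAlgClosed.exists_pow_nat_eq (s ^ 2 - 4 * m) (n := 2) (by norm_num)
  have h1 : (s + d) / 2 + (s - d) / 2 = s := by ring
  have h2 : (s + d) / 2 * ((s - d) / 2) = m := by linear_combination -hd / 4
  rcases le_total ‖(s + d) / 2‖ ‖(s - d) / 2‖ with h | h
  · exact ⟨_, _, h1, h2, h⟩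
  · exact ⟨_, _, by rw [add_comm, h1], by rw [mul_comm, h2], h⟩

/-- The slow and the fast eigenvalue of a mode. -/
theorem exists_slow_fast {b ε : ℝ} (hb : |b| < 1) (hε : 0 < ε) (k : ℤ) (hk : 4 * |(k : ℝ)| ≤ 1 / ε) :
    ∃ x y : ℂ, x + y = -(1 / ε) ∧ x * y = k ^ 2 + Complex.I * k * b / ε ∧ ‖x‖ ≤ 4 * |(k : ℝ)| ∧
      ‖y‖ ≤ 2 / ε ∧ y.re ≤ -(1 / ε) + 4 * |(k : ℝ)| := by
  obtain ⟨x, y, hs, hm, hxy⟩ := exists_roots (-(1 / ε : ℂ)) (k ^ 2 + Complex.I * k * b / ε)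
  have hε' : 0 < 1 / ε := by positivity
  have hnorm : ‖(-(1 / ε : ℂ))‖ = 1 / ε := by
    rw [norm_neg, norm_div, norm_one, Complex.norm_real, Real.norm_of_nonneg hε.le]
  -- The larger root has at least half the modulus of the sum. Dividing the product, of size at most
  -- `2 |k| / ε`, by it bounds the smaller root by `4 |k|`.
  have hy : 1 / ε ≤ 2 * ‖y‖ := by
    have := norm_add_le x y
    rw [hs, hnorm] at this
    linarith
  have hprod : ‖x‖ * ‖y‖ ≤ 2 * |(k : ℝ)| * (1 / ε) := by
    rw [← norm_mul, hm]
    have e1 : ‖(k : ℂ) ^ 2‖ = |(k : ℝ)| * |(k : ℝ)| := by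
      rw [norm_pow, Complex.norm_intCast, pow_two]
    have e2 : ‖Complex.I * k * b / ε‖ = |(k : ℝ)| * |b| * (1 / ε) := by
      rw [norm_div, norm_mul, norm_mul, Complex.norm_I, Complex.norm_intCast, Complex.norm_real,
        Complex.norm_real, Real.norm_of_nonneg hε.le, Real.norm_eq_abs]
      ring
    have h3 := norm_add_le ((k : ℂ) ^ 2) (Complex.I * k * b / ε)
    rw [e1, e2] at h3
    have h4 : |(k : ℝ)| * |(k : ℝ)| ≤ |(k : ℝ)| * (1 / ε) :=
      mul_le_mul_of_nonneg_left (by linarith [abs_nonneg (k : ℝ)]) (abs_nonneg _)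
    have h5 : |(k : ℝ)| * |b| * (1 / ε) ≤ |(k : ℝ)| * 1 * (1 / ε) := by gcongr
    linarith
  have hx : ‖x‖ ≤ 4 * |(k : ℝ)| := by
    by_contra! h
    have h1 : 4 * |(k : ℝ)| * (1 / ε) ≤ 2 * (‖x‖ * ‖y‖) - (‖x‖ - 4 * |(k : ℝ)|) * (1 / ε) := by
      nlinarith [norm_nonneg x]
    have h2 : 0 < (‖x‖ - 4 * |(k : ℝ)|) * (1 / ε) := mul_pos (by linarith) hε'
    linarith
  have hyx : y = -(1 / ε) - x := by rw [← hs]; ring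
  refine ⟨x, y, hs, hm, hx, ?_, ?_⟩
  · rw [hyx]
    refine (norm_sub_le _ _).trans ?_
    rw [hnorm]
    have : 2 / ε = 1 / ε + 1 / ε := by ring
    linarith
  · have h1 : y.re = -(1 / ε) - x.re := by
      rw [hyx, Complex.sub_re]
      congr 1
      have : (-(1 / ε : ℂ)) = ((-(1 / ε) : ℝ) : ℂ) := by push_cast; rfl
      rw [this, Complex.ofReal_re]
    have h2 := (abs_le.1 (Complex.abs_re_le_norm x)).1
    linarith

/-- Cayley–Hamilton for the 2×2 mode matrix, which has trace `-1/ε` and determinant `k² + ikb/ε`.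
Both components therefore obey the same second-order equation. -/
theorem modeRhs_modeRhs_fst (b ε : ℝ) (k : ℤ) (v : (ℝ → ℂ) × (ℝ → ℂ)) (t : ℝ) :
    (modeRhs b ε k (modeRhs b ε k v)).1 t
      = -(1 / ε) * (modeRhs b ε k v).1 t - (k ^ 2 + Complex.I * k * b / ε) * v.1 t := by
  simp only [modeRhs]
  linear_combination (k : ℂ) ^ 2 * v.1 t * Complex.I_sq

theorem modeRhs_modeRhs_snd (b ε : ℝ) (k : ℤ) (v : (ℝ → ℂ) × (ℝ → ℂ)) (t : ℝ) :
    (modeRhs b ε k (modeRhs b ε k v)).2 t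
      = -(1 / ε) * (modeRhs b ε k v).2 t - (k ^ 2 + Complex.I * k * b / ε) * v.2 t := by
  simp only [modeRhs]
  linear_combination (k : ℂ) ^ 2 * v.2 t * Complex.I_sq

theorem norm_modeRhs_le {b ε : ℝ} (hb : |b| < 1) (hε : 0 < ε) (k : ℤ) (v : (ℝ → ℂ) × (ℝ → ℂ))
    (t : ℝ) : ‖(modeRhs b ε k v).1 t‖ + ‖(modeRhs b ε k v).2 t‖
      ≤ (2 * |(k : ℝ)| + 1 / ε) * (‖v.1 t‖ + ‖v.2 t‖) := by
  have hs : 0 < 1 - b ^ 2 := by linarith [(sq_lt_one_iff_abs_lt_one b).2 hb]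
  have hs1 : 1 - b ^ 2 ≤ 1 := by nlinarith [sq_nonneg b]
  have hbz : ∀ z : ℂ, ‖(b : ℂ) * z‖ ≤ ‖z‖ := fun z => by
    rw [norm_mul, Complex.norm_real]
    exact mul_le_of_le_one_left (norm_nonneg _) hb.le
  have hsz : ∀ z : ℂ, ‖(1 - (b : ℂ) ^ 2) * z‖ ≤ ‖z‖ := fun z => by
    have hcast : 1 - (b : ℂ) ^ 2 = ((1 - b ^ 2 : ℝ) : ℂ) := by push_cast; rfl
    rw [hcast, norm_mul, Complex.norm_real, Real.norm_of_nonneg hs.le]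
    exact mul_le_of_le_one_left (norm_nonneg _) hs1
  have h1 : ‖(modeRhs b ε k v).1 t‖ ≤ |(k : ℝ)| * (‖v.1 t‖ + ‖v.2 t‖) := by
    simp only [modeRhs]
    rw [norm_mul, norm_neg, norm_mul, Complex.norm_I, one_mul, Complex.norm_intCast]
    exact mul_le_mul_of_nonneg_left
      ((norm_add_le _ _).trans (add_le_add (hbz _) le_rfl)) (abs_nonneg _)
  have h2 : ‖(modeRhs b ε k v).2 t‖ ≤ |(k : ℝ)| * (‖v.1 t‖ + ‖v.2 t‖) + 1 / ε * ‖v.2 t‖ := by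
    simp only [modeRhs]
    refine (norm_sub_le _ _).trans (add_le_add ?_ (le_of_eq ?_))
    · rw [norm_mul, norm_neg, norm_mul, Complex.norm_I, one_mul, Complex.norm_intCast]
      exact mul_le_mul_of_nonneg_left
        ((norm_sub_le _ _).trans (add_le_add (hsz _) (hbz _))) (abs_nonneg _)
    · rw [norm_mul, norm_div, norm_one, Complex.norm_real, Real.norm_of_nonneg hε.le]
  have h3 : 0 ≤ 1 / ε * ‖v.1 t‖ := by positivity
  linarith

/-- A crude bound, of use for the modes with `1 / ε ≲ 1 + |k|`, where a factor `1 / ε` costs no more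
than a space derivative. -/
theorem norm_modeDeriv_le {b ε : ℝ} (hb : |b| < 1) (hε : 0 < ε) (k : ℤ) (v : (ℝ → ℂ) × (ℝ → ℂ))
    (r : ℕ) (t : ℝ) : ‖(modeDeriv b ε k v r).1 t‖ + ‖(modeDeriv b ε k v r).2 t‖
      ≤ (2 * |(k : ℝ)| + 1 / ε) ^ r * (‖v.1 t‖ + ‖v.2 t‖) := by
  induction r with
  | zero => simp [modeDeriv]
  | succ r ih =>
    rw [modeDeriv_succ, pow_succ', mul_assoc]
    exact (norm_modeRhs_le hb hε k _ t).trans (mul_le_mul_of_nonneg_left ih (by positivity))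

/-- Off the slow subspace, all time derivatives are governed by the fast eigenvalue. -/
theorem modeDeriv_sub_slow {b ε : ℝ} {k : ℤ} {x y : ℂ} (hs : x + y = -(1 / ε))
    (hm : x * y = k ^ 2 + Complex.I * k * b / ε) (v : (ℝ → ℂ) × (ℝ → ℂ)) (r : ℕ) (t : ℝ) :
    (modeDeriv b ε k v (r + 1)).1 t - x * (modeDeriv b ε k v r).1 t
        = y ^ r * ((modeRhs b ε k v).1 t - x * v.1 t) ∧
    (modeDeriv b ε k v (r + 1)).2 t - x * (modeDeriv b ε k v r).2 t
        = y ^ r * ((modeRhs b ε k v).2 t - x * v.2 t) := by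
  induction r with
  | zero => simp [modeDeriv]
  | succ r ih =>
    rw [modeDeriv_succ _ _ _ _ (r + 1), modeDeriv_succ _ _ _ _ r] at *
    rw [modeRhs_modeRhs_fst, modeRhs_modeRhs_snd, ← hs, ← hm]
    constructor
    · linear_combination y * ih.1
    · linear_combination y * ih.2

end

/-! ### Decay of the fast component and bounds after the layer -/

section

open Finset ComplexConjugate

theorem IsMode.norm_add_norm_le {b ε : ℝ} (hb : |b| < 1) (hε : 0 < ε) {k : ℤ}
    {v : (ℝ → ℂ) × (ℝ → ℂ)} (hv : IsMode b ε k v) {t : ℝ} (ht : 0 ≤ t) :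
    ‖v.1 t‖ + ‖v.2 t‖ ≤ 2 / (1 - b ^ 2) * (‖v.1 0‖ + ‖v.2 0‖) := by
  have hs : 0 < 1 - b ^ 2 := by linarith [(sq_lt_one_iff_abs_lt_one b).2 hb]
  have hs1 : 1 - b ^ 2 ≤ 1 := by nlinarith [sq_nonneg b]
  have h := hv.norm_sq_le hb hε le_rfl ht
  have hc : 1 ≤ 1 / (1 - b ^ 2) := by rwa [one_le_div hs]
  set c := 1 / (1 - b ^ 2) with hcdef
  rw [show 2 / (1 - b ^ 2) = 2 * c by rw [hcdef]; ring]
  refine abs_le_of_sq_le_sq' ?_ (by positivity) |>.2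
  have h1 : (‖v.1 t‖ + ‖v.2 t‖) ^ 2 ≤ 2 * (‖v.1 t‖ ^ 2 + ‖v.2 t‖ ^ 2) := by
    nlinarith [sq_nonneg (‖v.1 t‖ - ‖v.2 t‖)]
  have h2 : ‖v.1 0‖ ^ 2 + ‖v.2 0‖ ^ 2 ≤ (‖v.1 0‖ + ‖v.2 0‖) ^ 2 := by
    nlinarith [mul_nonneg (norm_nonneg (v.1 0)) (norm_nonneg (v.2 0))]
  have h3 : c * (‖v.1 0‖ ^ 2 + ‖v.2 0‖ ^ 2) ≤ c * c * (‖v.1 0‖ + ‖v.2 0‖) ^ 2 := by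
    rw [mul_assoc]
    refine mul_le_mul_of_nonneg_left (h2.trans ?_) (by positivity)
    exact le_mul_of_one_le_left (by positivity) hc
  have h4 : 0 ≤ c * c * (‖v.1 0‖ + ‖v.2 0‖) ^ 2 := by positivity
  calc _ ≤ 2 * (c * c * (‖v.1 0‖ + ‖v.2 0‖) ^ 2) := by linarith
    _ ≤ 4 * (c * c * (‖v.1 0‖ + ‖v.2 0‖) ^ 2) := by linarith
    _ = _ := by ring

/-- The fast component has decayed after the initial layer. -/
theorem exp_fast_le {p : ℕ} {ε K T₀ : ℝ} (hε : 0 < ε) (hε1 : ε < 1) {y : ℂ}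
    (hy : y.re ≤ -(1 / ε) + 4 * K) (hK : 4 * (p + 3) * K ≤ 1 / ε)
    (hT : ((p : ℝ) + 3) * ε * Real.log (1 / ε) ≤ T₀) :
    ‖Complex.exp (y * T₀)‖ ≤ ε ^ (p + 2) := by
  have hlog : 0 ≤ Real.log (1 / ε) := Real.log_nonneg (by rw [one_le_div hε]; exact hε1.le)
  have hT0 : 0 ≤ T₀ := le_trans (by positivity) hT
  rw [Complex.norm_exp, Complex.re_mul_ofReal]
  have hp : (0 : ℝ) < p + 3 := by positivity
  -- The slow root can take away at most the fraction `1 / (p + 3)` of the decay rate `1 / ε`. The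
  -- length `(p + 3) ε log (1/ε)` of the layer then yields exactly the power `p + 2` of `ε`.
  have h1 : y.re ≤ -((p + 2) / ((p + 3) * ε)) := by
    have : 4 * K ≤ 1 / ε / (p + 3) := by
      rw [le_div_iff₀ hp]
      linarith
    refine hy.trans ((add_le_add_right this _).trans (le_of_eq ?_))
    field_simp
    ring
  have h2 : y.re * T₀ ≤ (p + 2) * Real.log ε := by
    calc y.re * T₀ ≤ -((p + 2) / ((p + 3) * ε)) * T₀ := mul_le_mul_of_nonneg_right h1 hT0
      _ = -((p + 2) / ((p + 3) * ε) * T₀) := by ring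
      _ ≤ -((p + 2) / ((p + 3) * ε) * ((p + 3) * ε * Real.log (1 / ε))) := by gcongr
      _ = _ := by
        rw [one_div, Real.log_inv]
        field_simp
  calc Real.exp (y.re * T₀) ≤ Real.exp ((p + 2) * Real.log ε) := Real.exp_le_exp.2 h2
    _ = ε ^ (p + 2) := by
      rw [show ((p : ℝ) + 2) = ((p + 2 : ℕ) : ℝ) by push_cast; rfl, Real.exp_nat_mul,
        Real.exp_log hε]

theorem IsMode.modeRhs_sub_slow_eq {b ε : ℝ} {k : ℤ} {v : (ℝ → ℂ) × (ℝ → ℂ)} (hv : IsMode b ε k v)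
    {x y : ℂ} (hs : x + y = -(1 / ε)) (hm : x * y = k ^ 2 + Complex.I * k * b / ε) {t : ℝ}
    (ht : 0 ≤ t) :
    (IMEXBDF.modeRhs b ε k v).1 t - x * v.1 t
        = Complex.exp (y * t) * ((IMEXBDF.modeRhs b ε k v).1 0 - x * v.1 0) ∧
    (IMEXBDF.modeRhs b ε k v).2 t - x * v.2 t
        = Complex.exp (y * t) * ((IMEXBDF.modeRhs b ε k v).2 0 - x * v.2 0) := by
  constructor
  · refine eq_exp_mul_of_hasDerivWithinAt
      (f := fun t => (IMEXBDF.modeRhs b ε k v).1 t - x * v.1 t) (fun s hs' => ?_) ht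
    refine ((hv.modeRhs s hs').1.sub ((hv s hs').1.const_mul x)).congr_deriv ?_
    rw [modeRhs_modeRhs_fst, ← hs, ← hm]
    ring
  · refine eq_exp_mul_of_hasDerivWithinAt
      (f := fun t => (IMEXBDF.modeRhs b ε k v).2 t - x * v.2 t) (fun s hs' => ?_) ht
    refine ((hv.modeRhs s hs').2.sub ((hv s hs').2.const_mul x)).congr_deriv ?_
    rw [modeRhs_modeRhs_snd, ← hs, ← hm]
    ring

/-- The derivative of order `r + 1` is `x` times that of order `r` plus a fast part. Here `‖x‖ ≤ 4
|k|`, and the fast part is at most `(2/ε)^{r+1} ε^{p+2}` times the initial size, which is bounded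
because `r + 1 ≤ p + 2`. Each step thus costs a factor `4 (1 + |k|)` and adds one bounded term. -/
theorem stiff_layer_bound {p : ℕ} {b ε T₀ : ℝ} (hb : |b| < 1) (hε : 0 < ε) {k : ℤ}
    (hk : 4 * ((p : ℝ) + 3) * (1 + |(k : ℝ)|) ≤ 1 / ε)
    (hT : ((p : ℝ) + 3) * ε * Real.log (1 / ε) ≤ T₀)
    {v : (ℝ → ℂ) × (ℝ → ℂ)} (hv : IsMode b ε k v) (r : ℕ) (hr : r ≤ p + 2) :
    ‖(modeDeriv b ε k v r).1 T₀‖ + ‖(modeDeriv b ε k v r).2 T₀‖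
      ≤ (2 / (1 - b ^ 2) + r * 2 ^ (p + 2)) * (4 * (1 + |(k : ℝ)|)) ^ r
        * (‖v.1 0‖ + ‖v.2 0‖) := by
  have hk0 := abs_nonneg (k : ℝ)
  have hp0 : (0 : ℝ) ≤ p := Nat.cast_nonneg p
  have hpk : 0 ≤ (p : ℝ) * (1 + |(k : ℝ)|) := by positivity
  have h12 : 12 * (1 + |(k : ℝ)|) ≤ 1 / ε := by linarith
  have hε1 : ε < 1 := by
    by_contra! h
    have : 1 / ε ≤ 1 := by rw [div_le_one hε]; exact h
    linarith
  have hlog : 0 ≤ Real.log (1 / ε) := Real.log_nonneg (by rw [one_le_div hε]; exact hε1.le)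
  have hT0 : 0 ≤ T₀ := le_trans (by positivity) hT
  have hs : 0 < 1 - b ^ 2 := by linarith [(sq_lt_one_iff_abs_lt_one b).2 hb]
  obtain ⟨x, y, hxs, hxm, hx, hy, hyre⟩ := exists_slow_fast hb hε k (by linarith)
  have hexp := exp_fast_le (p := p) hε hε1 hyre (by nlinarith) hT
  set n₀ := ‖v.1 0‖ + ‖v.2 0‖ with hn₀
  have hn₀0 : 0 ≤ n₀ := by positivity
  obtain ⟨hP1, hP2⟩ := hv.modeRhs_sub_slow_eq hxs hxm hT0
  have hP : ‖(modeRhs b ε k v).1 T₀ - x * v.1 T₀‖ + ‖(modeRhs b ε k v).2 T₀ - x * v.2 T₀‖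
      ≤ ε ^ (p + 2) * (2 / ε * n₀) := by
    rw [hP1, hP2, norm_mul, norm_mul, ← mul_add]
    refine mul_le_mul hexp ?_ (by positivity) (by positivity)
    have h1 := norm_modeRhs_le hb hε k v 0
    have h2 := norm_sub_le ((modeRhs b ε k v).1 0) (x * v.1 0)
    have h3 := norm_sub_le ((modeRhs b ε k v).2 0) (x * v.2 0)
    rw [norm_mul] at h2 h3
    have h4 : ‖x‖ * (‖v.1 0‖ + ‖v.2 0‖) ≤ 4 * |(k : ℝ)| * n₀ := by gcongr
    have h5 : (6 * |(k : ℝ)| + 1 / ε) * n₀ ≤ 2 / ε * n₀ := by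
      refine mul_le_mul_of_nonneg_right ?_ hn₀0
      have : 2 / ε = 1 / ε + 1 / ε := by ring
      linarith
    linarith
  induction r with
  | zero =>
    simpa [modeDeriv] using hv.norm_add_norm_le hb hε hT0
  | succ r ih =>
    have ih := ih (by omega)
    obtain ⟨e1, e2⟩ := modeDeriv_sub_slow hxs hxm v r T₀
    have h1 := norm_add_le ((modeDeriv b ε k v (r + 1)).1 T₀ - x * (modeDeriv b ε k v r).1 T₀)
      (x * (modeDeriv b ε k v r).1 T₀)
    have h2 := norm_add_le ((modeDeriv b ε k v (r + 1)).2 T₀ - x * (modeDeriv b ε k v r).2 T₀)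
      (x * (modeDeriv b ε k v r).2 T₀)
    rw [sub_add_cancel, e1, norm_mul, norm_pow, norm_mul x] at h1
    rw [sub_add_cancel, e2, norm_mul, norm_pow, norm_mul x] at h2
    have h3 : ‖y‖ ^ r * (‖(modeRhs b ε k v).1 T₀ - x * v.1 T₀‖
        + ‖(modeRhs b ε k v).2 T₀ - x * v.2 T₀‖) ≤ 2 ^ (p + 2) * n₀ := by
      obtain ⟨s, hs'⟩ : ∃ s, p + 1 = r + s := ⟨p + 1 - r, by omega⟩
      calc _ ≤ (2 / ε) ^ r * (ε ^ (p + 2) * (2 / ε * n₀)) := by gcongr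
        _ = 2 ^ (r + 1) * ε ^ s * n₀ := by
          rw [show p + 2 = r + s + 1 by omega, div_pow]
          field_simp
          ring
        _ ≤ 2 ^ (p + 2) * 1 * n₀ := by
          gcongr
          · norm_num
          · exact pow_le_one₀ hε.le hε1.le
        _ = _ := by ring
    have hA : (1 : ℝ) ≤ 4 * (1 + |(k : ℝ)|) := by linarith
    have h4 : ‖x‖ * (‖(modeDeriv b ε k v r).1 T₀‖ + ‖(modeDeriv b ε k v r).2 T₀‖)
        ≤ 4 * (1 + |(k : ℝ)|) * ((2 / (1 - b ^ 2) + r * 2 ^ (p + 2))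
          * (4 * (1 + |(k : ℝ)|)) ^ r * n₀) := by
      refine mul_le_mul (by linarith) ih (by positivity) (by positivity)
    have h5 : (2 : ℝ) ^ (p + 2) * n₀ ≤ 2 ^ (p + 2) * (4 * (1 + |(k : ℝ)|)) ^ (r + 1) * n₀ := by
      refine mul_le_mul_of_nonneg_right ?_ hn₀0
      exact le_mul_of_one_le_right (by positivity) (one_le_pow₀ hA)
    have e : (2 / (1 - b ^ 2) + ((r + 1 : ℕ) : ℝ) * 2 ^ (p + 2)) * (4 * (1 + |(k : ℝ)|)) ^ (r +
      1) * n₀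
        = 4 * (1 + |(k : ℝ)|) * ((2 / (1 - b ^ 2) + r * 2 ^ (p + 2))
          * (4 * (1 + |(k : ℝ)|)) ^ r * n₀) + 2 ^ (p + 2) * (4 * (1 + |(k : ℝ)|)) ^ (r + 1) * n₀ :=
            by
      push_cast
      ring
    rw [e]
    linarith

/-- After the initial layer the time derivatives are bounded by the initial data, uniformly in
`ε`, with the loss of one space derivative for each time derivative. -/
theorem exists_layer_bound (p : ℕ) {b : ℝ} (hb : |b| < 1) :
    ∃ C : ℝ, 0 < C ∧ ∀ (ε T₀ : ℝ) (k : ℤ) (v : (ℝ → ℂ) × (ℝ → ℂ)), 0 < ε → 0 ≤ T₀ →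
      ((p : ℝ) + 3) * ε * Real.log (1 / ε) ≤ T₀ → IsMode b ε k v → ∀ r ≤ p + 2,
      ‖(modeDeriv b ε k v r).1 T₀‖ ^ 2 + ‖(modeDeriv b ε k v r).2 T₀‖ ^ 2
        ≤ C * (1 + (k : ℝ) ^ 2) ^ r * (‖v.1 0‖ ^ 2 + ‖v.2 0‖ ^ 2) := by
  have hs : 0 < 1 - b ^ 2 := by linarith [(sq_lt_one_iff_abs_lt_one b).2 hb]
  have hp0 : (0 : ℝ) ≤ p := Nat.cast_nonneg p
  set A : ℝ := (2 / (1 - b ^ 2) + (p + 2) * 2 ^ (p + 2)) * (4 * (p + 3) + 2) ^ (p + 2) with hA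
  have hApos : 0 < A := by positivity
  refine ⟨2 * A ^ 2 * 2 ^ (p + 2), by positivity, ?_⟩
  intro ε T₀ k v hε hT0 hT hv r hr
  have hk0 := abs_nonneg (k : ℝ)
  set L := 1 + |(k : ℝ)| with hL
  have hLpos : 0 < L := by positivity
  set n₀ := ‖v.1 0‖ + ‖v.2 0‖ with hn₀
  have key : ‖(modeDeriv b ε k v r).1 T₀‖ + ‖(modeDeriv b ε k v r).2 T₀‖ ≤ A * L ^ r * n₀ := by
    have hr' : (r : ℝ) ≤ p + 2 := by exact_mod_cast hr
    have hM : (1 : ℝ) ≤ 4 * (p + 3) + 2 := by linarith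
    -- Either the two roots are well separated, or `1 / ε` is itself dominated by `1 + |k|`. The
    -- second case covers every `ε ≥ 1`.
    rcases le_total (4 * ((p : ℝ) + 3) * L) (1 / ε) with h | h
    · refine (stiff_layer_bound hb hε h hT hv r hr).trans ?_
      rw [hA, mul_pow, ← mul_assoc]
      refine mul_le_mul_of_nonneg_right (mul_le_mul_of_nonneg_right ?_ (by positivity))
        (by positivity)
      have h1 : (4 : ℝ) ^ r ≤ (4 * (p + 3) + 2) ^ (p + 2) :=
        calc (4 : ℝ) ^ r ≤ (4 * (p + 3) + 2) ^ r := by gcongr; linarith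
          _ ≤ _ := pow_le_pow_right₀ hM hr
      gcongr
    · refine (norm_modeDeriv_le hb hε k v r T₀).trans ?_
      have h1 : 2 * |(k : ℝ)| + 1 / ε ≤ (4 * (p + 3) + 2) * L := by linarith
      calc _ ≤ ((4 * (p + 3) + 2) * L) ^ r * (2 / (1 - b ^ 2) * n₀) := by
            gcongr
            exact hv.norm_add_norm_le hb hε hT0
        _ = 2 / (1 - b ^ 2) * (4 * (p + 3) + 2) ^ r * (L ^ r * n₀) := by rw [mul_pow]; ring
        _ ≤ A * (L ^ r * n₀) := by
            rw [hA]
            gcongr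
            exact le_add_of_nonneg_right (by positivity)
        _ = _ := by ring
  have h1 : ‖(modeDeriv b ε k v r).1 T₀‖ ^ 2 + ‖(modeDeriv b ε k v r).2 T₀‖ ^ 2
      ≤ (‖(modeDeriv b ε k v r).1 T₀‖ + ‖(modeDeriv b ε k v r).2 T₀‖) ^ 2 := by
    nlinarith [mul_nonneg (norm_nonneg ((modeDeriv b ε k v r).1 T₀))
      (norm_nonneg ((modeDeriv b ε k v r).2 T₀))]
  have hL2 : L ^ 2 ≤ 2 * (1 + (k : ℝ) ^ 2) := by
    rw [hL, ← sq_abs (k : ℝ)]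
    nlinarith [sq_nonneg (1 - |(k : ℝ)|)]
  have hn2 : n₀ ^ 2 ≤ 2 * (‖v.1 0‖ ^ 2 + ‖v.2 0‖ ^ 2) := by
    nlinarith [sq_nonneg (‖v.1 0‖ - ‖v.2 0‖)]
  clear_value A
  calc _ ≤ (A * L ^ r * n₀) ^ 2 := h1.trans (by gcongr)
    _ = A ^ 2 * (L ^ 2) ^ r * n₀ ^ 2 := by
        rw [mul_pow, mul_pow, ← pow_mul, ← pow_mul, mul_comm r]
    _ ≤ A ^ 2 * (2 * (1 + (k : ℝ) ^ 2)) ^ r * (2 * (‖v.1 0‖ ^ 2 + ‖v.2 0‖ ^ 2)) := by gcongr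
    _ = 2 * A ^ 2 * 2 ^ r * (1 + (k : ℝ) ^ 2) ^ r * (‖v.1 0‖ ^ 2 + ‖v.2 0‖ ^ 2) := by
        rw [mul_pow 2 (1 + (k : ℝ) ^ 2) r]; ring
    _ ≤ _ := by
        gcongr
        norm_num

end

section

open Finset ComplexConjugate MeasureTheory

/-! ### Fourier coefficients -/

theorem expMode_neg_eq_fourier (k : ℤ) (x : ℝ) :
    (fourier (-k) (x : AddCircle (2 * Real.pi - 0)) : ℂ) = expMode (-k) x := by
  rw [fourier_coe_apply, expMode]
  congr 1
  have := Real.pi_ne_zero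
  push_cast
  rw [sub_zero]
  field_simp

theorem coeff_eq_integral (f : ℝ → ℂ) (k : ℤ) :
    coeff f k = (1 / (2 * Real.pi) : ℂ) * ∫ x in (0 : ℝ)..(2 * Real.pi), f x * expMode (-k) x := by
  rw [coeff, fourierCoeffOn_eq_integral, sub_zero, Complex.real_smul]
  push_cast
  congr 1
  refine intervalIntegral.integral_congr fun x _ => ?_
  simp only [smul_eq_mul]
  rw [mul_comm, ← expMode_neg_eq_fourier, sub_zero]

theorem hasDerivAt_expMode (k : ℤ) (x : ℝ) :
    HasDerivAt (expMode k) (Complex.I * k * expMode k x) x := by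
  have h := ((Complex.ofRealCLM.hasDerivAt (x := x)).const_mul (Complex.I * k)).cexp
  have e : expMode k = fun x : ℝ => Complex.exp (Complex.I * k * x) := rfl
  rw [e]
  simpa [mul_comm] using h

theorem contDiff_expMode (k : ℤ) : ContDiff ℝ ∞ (expMode k) := by
  unfold expMode
  exact (contDiff_const.mul Complex.ofRealCLM.contDiff).cexp

theorem periodic_expMode (k : ℤ) : Function.Periodic (expMode k) (2 * Real.pi) := by
  intro x
  rw [expMode, expMode, Complex.exp_eq_exp_iff_exists_int]
  exact ⟨k, by push_cast; ring⟩

theorem MemL2.intervalIntegrable {f : ℝ → ℂ} (hf : MemL2 f) :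
    IntervalIntegrable f volume 0 (2 * Real.pi) := by
  rw [intervalIntegrable_iff_integrableOn_Ioc_of_le Real.two_pi_pos.le]
  exact MemLp.integrable (by norm_num) hf

theorem intervalIntegrable_mul_expMode {f : ℝ → ℂ}
    (hf : IntervalIntegrable f volume 0 (2 * Real.pi)) (k : ℤ) :
    IntervalIntegrable (fun x => f x * expMode k x) volume 0 (2 * Real.pi) :=
  hf.mul_continuousOn (contDiff_expMode k).continuous.continuousOn

theorem coeff_const_mul (c : ℂ) (f : ℝ → ℂ) (k : ℤ) : coeff (fun x => c * f x) k = c * coeff f k :=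
  fourierCoeffOn.const_mul _ _ _ _

theorem coeff_add {f g : ℝ → ℂ} (hf : IntervalIntegrable f volume 0 (2 * Real.pi))
    (hg : IntervalIntegrable g volume 0 (2 * Real.pi)) (k : ℤ) :
    coeff (fun x => f x + g x) k = coeff f k + coeff g k := by
  simp only [coeff_eq_integral, add_mul]
  rw [intervalIntegral.integral_add (intervalIntegrable_mul_expMode hf _)
    (intervalIntegrable_mul_expMode hg _), mul_add]

theorem coeff_sub {f g : ℝ → ℂ} (hf : IntervalIntegrable f volume 0 (2 * Real.pi))
    (hg : IntervalIntegrable g volume 0 (2 * Real.pi)) (k : ℤ) :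
    coeff (fun x => f x - g x) k = coeff f k - coeff g k := by
  simp only [coeff_eq_integral, sub_mul]
  rw [intervalIntegral.integral_sub (intervalIntegrable_mul_expMode hf _)
    (intervalIntegrable_mul_expMode hg _), mul_sub]

theorem coeff_sum {ι : Type*} (s : Finset ι) {f : ι → ℝ → ℂ}
    (hf : ∀ i ∈ s, IntervalIntegrable (f i) volume 0 (2 * Real.pi)) (k : ℤ) :
    coeff (fun x => ∑ i ∈ s, f i x) k = ∑ i ∈ s, coeff (f i) k := by
  simp only [coeff_eq_integral, sum_mul]
  rw [intervalIntegral.integral_finsetSum fun i hi => intervalIntegrable_mul_expMode (hf i hi) _,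
    mul_sum]

theorem coeff_expMode (j k : ℤ) : coeff (expMode j) k = if j = k then 1 else 0 := by
  have hmul : ∀ x, expMode j x * expMode (-k) x = expMode (j - k) x := fun x => by
    rw [expMode, expMode, expMode, ← Complex.exp_add]
    congr 1
    push_cast
    ring
  have hpi : (Real.pi : ℂ) ≠ 0 := by exact_mod_cast Real.pi_ne_zero
  rw [coeff_eq_integral]
  simp only [hmul]
  split_ifs with h
  · subst h
    simp [expMode]
    field_simp
  · have hjk : Complex.I * ((j - k : ℤ) : ℂ) ≠ 0 :=
      mul_ne_zero Complex.I_ne_zero (by exact_mod_cast sub_ne_zero.2 h)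
    have hd : ∀ x ∈ Set.uIcc 0 (2 * Real.pi), HasDerivAt
        (fun y => (Complex.I * ((j - k : ℤ) : ℂ))⁻¹ * expMode (j - k) y) (expMode (j - k) x) x := by
      intro x _
      have h1 := (hasDerivAt_expMode (j - k) x).const_mul (Complex.I * ((j - k : ℤ) : ℂ))⁻¹
      rwa [inv_mul_cancel_left₀ hjk] at h1
    rw [intervalIntegral.integral_eq_sub_of_hasDerivAt hd
      ((contDiff_expMode _).continuous.intervalIntegrable _ _)]
    have := periodic_expMode (j - k) 0
    rw [zero_add] at this
    rw [this, sub_self, mul_zero]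

/-- The Fourier coefficients of a weak solution solve the mode equations. -/
theorem IsWeakSolution.isMode {b ε : ℝ} {u w : ℝ → ℝ → ℂ} (h : IsWeakSolution b ε u w) (k : ℤ) :
    IsMode b ε k (fun t => coeff (u t) k, fun t => coeff (w t) k) := by
  intro t ht
  have hu := intervalIntegrable_mul_expMode (h.memL2_u t ht).intervalIntegrable (-k)
  have hw := intervalIntegrable_mul_expMode (h.memL2_w t ht).intervalIntegrable (-k)
  have hd : deriv (expMode (-k)) = fun x => -(Complex.I * k) * expMode (-k) x := by
    funext x
    rw [(hasDerivAt_expMode (-k) x).deriv]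
    push_cast
    ring
  constructor
  · have h1 := (h.eq_u _ (contDiff_expMode (-k)) (periodic_expMode (-k)) t ht).const_mul
      (1 / (2 * Real.pi) : ℂ)
    have e : (fun τ => coeff (u τ) k) = fun τ => (1 / (2 * Real.pi) : ℂ)
        * ∫ x in (0 : ℝ)..(2 * Real.pi), u τ x * expMode (-k) x :=
      funext fun τ => coeff_eq_integral _ _
    simp only
    rw [e]
    refine h1.congr_deriv ?_
    have e2 : ∀ x, ((b : ℂ) * u t x + w t x) * (-(Complex.I * k) * expMode (-k) x)
        = -(Complex.I * k) * ((b : ℂ) * (u t x * expMode (-k) x) + w t x * expMode (-k) x) :=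
      fun x => by ring
    simp only [modeRhs, hd, e2, coeff_eq_integral]
    rw [intervalIntegral.integral_const_mul, intervalIntegral.integral_add (hu.const_mul _) hw,
      intervalIntegral.integral_const_mul]
    ring
  · have h1 := (h.eq_w _ (contDiff_expMode (-k)) (periodic_expMode (-k)) t ht).const_mul
      (1 / (2 * Real.pi) : ℂ)
    have e : (fun τ => coeff (w τ) k) = fun τ => (1 / (2 * Real.pi) : ℂ)
        * ∫ x in (0 : ℝ)..(2 * Real.pi), w τ x * expMode (-k) x :=
      funext fun τ => coeff_eq_integral _ _
    simp only
    rw [e]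
    refine h1.congr_deriv ?_
    have e2 : ∀ x, ((1 - (b : ℂ) ^ 2) * u t x - (b : ℂ) * w t x)
          * (-(Complex.I * k) * expMode (-k) x)
        = -(Complex.I * k) * ((1 - (b : ℂ) ^ 2) * (u t x * expMode (-k) x)
          - (b : ℂ) * (w t x * expMode (-k) x)) := fun x => by ring
    simp only [modeRhs, hd, e2, coeff_eq_integral]
    rw [intervalIntegral.integral_const_mul,
      intervalIntegral.integral_sub (hu.const_mul _) (hw.const_mul _),
      intervalIntegral.integral_const_mul, intervalIntegral.integral_const_mul]
    ring

theorem IsWeakSolution.timeDerivCoeff_eq {b ε : ℝ} {u w : ℝ → ℝ → ℂ} (h : IsWeakSolution b ε u w)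
    (r : ℕ) {t : ℝ} (ht : 0 ≤ t) (k : ℤ) :
    timeDerivCoeff r u t k
      = (modeDeriv b ε k (fun t => coeff (u t) k, fun t => coeff (w t) k) r).1 t ∧
    timeDerivCoeff r w t k
      = (modeDeriv b ε k (fun t => coeff (u t) k, fun t => coeff (w t) k) r).2 t :=
  ⟨(h.isMode k).isDerivSeq_fst.iteratedDerivWithin_eq r ht,
    (h.isMode k).isDerivSeq_snd.iteratedDerivWithin_eq r ht⟩

/-! ### Trigonometric polynomials -/

theorem contDiff_of_mem_trigPoly {N : ℕ} {f : ℝ → ℂ} (hf : f ∈ trigPoly N) : ContDiff ℝ ∞ f := by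
  induction hf using Submodule.span_induction with
  | mem f hf =>
    obtain ⟨j, -, rfl⟩ := hf
    exact contDiff_expMode j
  | zero => exact contDiff_const
  | add f g _ _ hf hg => exact hf.add hg
  | smul a f _ hf => exact contDiff_const.smul hf

theorem intervalIntegrable_of_mem_trigPoly {N : ℕ} {f : ℝ → ℂ} (hf : f ∈ trigPoly N) :
    IntervalIntegrable f volume 0 (2 * Real.pi) :=
  (contDiff_of_mem_trigPoly hf).continuous.intervalIntegrable _ _

theorem intervalIntegrable_deriv_of_mem_trigPoly {N : ℕ} {f : ℝ → ℂ} (hf : f ∈ trigPoly N) :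
    IntervalIntegrable (deriv f) volume 0 (2 * Real.pi) :=
  ((contDiff_of_mem_trigPoly hf).continuous_deriv (by simp)).intervalIntegrable _ _

theorem coeff_eq_zero_of_mem_trigPoly {N : ℕ} {f : ℝ → ℂ} (hf : f ∈ trigPoly N) {k : ℤ}
    (hk : k ∉ Set.Icc (-(N : ℤ)) N) : coeff f k = 0 := by
  induction hf using Submodule.span_induction with
  | mem f hf =>
    obtain ⟨j, hj, rfl⟩ := hf
    rw [coeff_expMode, if_neg]
    rintro rfl
    exact hk hj
  | zero => simp [coeff_eq_integral]
  | add f g hf hg ihf ihg =>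
    have := coeff_add (intervalIntegrable_of_mem_trigPoly hf)
      (intervalIntegrable_of_mem_trigPoly hg) k
    rw [ihf, ihg, add_zero] at this
    exact this
  | smul a f hf ih =>
    have := coeff_const_mul a f k
    rw [ih, mul_zero] at this
    exact this

theorem coeff_deriv_of_mem_trigPoly {N : ℕ} {f : ℝ → ℂ} (hf : f ∈ trigPoly N) (k : ℤ) :
    coeff (deriv f) k = Complex.I * k * coeff f k := by
  induction hf using Submodule.span_induction with
  | mem f hf =>
    obtain ⟨j, hj, rfl⟩ := hf
    have e : deriv (expMode j) = fun x => Complex.I * j * expMode j x :=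
      funext fun x => (hasDerivAt_expMode j x).deriv
    rw [e, coeff_const_mul, coeff_expMode]
    split_ifs with h
    · rw [h]
    · simp
  | zero =>
    have e : deriv (0 : ℝ → ℂ) = 0 := by
      funext x
      exact deriv_const x 0
    rw [e]
    simp [coeff_eq_integral]
  | add f g hf hg ihf ihg =>
    have e : deriv (f + g) = fun x => deriv f x + deriv g x := funext fun x =>
      deriv_add ((contDiff_of_mem_trigPoly hf).differentiable (by simp) x)
        ((contDiff_of_mem_trigPoly hg).differentiable (by simp) x)
    have h2 := coeff_add (intervalIntegrable_of_mem_trigPoly hf)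
      (intervalIntegrable_of_mem_trigPoly hg) k
    rw [e, coeff_add (intervalIntegrable_deriv_of_mem_trigPoly hf)
      (intervalIntegrable_deriv_of_mem_trigPoly hg), ihf, ihg, ← mul_add, ← h2]
    rfl
  | smul a f hf ih =>
    have e : deriv (a • f) = fun x => a * deriv f x := funext fun x =>
      deriv_const_smul a ((contDiff_of_mem_trigPoly hf).differentiable (by simp) x)
    have h2 := coeff_const_mul a f k
    rw [e, coeff_const_mul, ih, mul_left_comm, ← h2]
    rfl

theorem coeff_proj (N : ℕ) (f : ℝ → ℂ) {k : ℤ} (hk : k ∈ Set.Icc (-(N : ℤ)) N) :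
    coeff (proj N f) k = coeff f k := by
  have e : proj N f = fun x => ∑ j ∈ Finset.Icc (-(N : ℤ)) (N : ℤ), coeff f j * expMode j x := rfl
  rw [e, coeff_sum]
  · simp only [coeff_const_mul, coeff_expMode]
    simp [Set.mem_Icc.1 hk]
  · intro j _
    exact ((contDiff_expMode j).continuous.intervalIntegrable _ _).const_mul _

end

/-! ### The scheme in Fourier coefficients and Parseval's identity -/

section

open Finset ComplexConjugate MeasureTheory

theorem coeff_bdf_step {N m l : ℕ} (α γ : ℕ → ℝ) (a c h : ℂ) {F G H : ℕ → ℝ → ℂ}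
    (hF : ∀ n, F n ∈ trigPoly N) (hG : ∀ n, G n ∈ trigPoly N) (hH : ∀ n, H n ∈ trigPoly N) (n : ℕ)
    (k : ℤ) :
    coeff (fun x => ∑ i ∈ range m, (α i : ℂ) * F (n + i) x
      + h * ∑ i ∈ range l, (γ i : ℂ) * deriv (fun y => a * G (n + i) y + c * H (n + i) y) x) k
    = ∑ i ∈ range m, (α i : ℂ) * coeff (F (n + i)) k
      + h * (k * Complex.I * (a * ∑ i ∈ range l, (γ i : ℂ) * coeff (G (n + i)) k
        + c * ∑ i ∈ range l, (γ i : ℂ) * coeff (H (n + i)) k)) := by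
  have hmem : ∀ j, (fun y => a * G j y + c * H j y) ∈ trigPoly N := fun j =>
    (trigPoly N).add_mem ((trigPoly N).smul_mem a (hG j)) ((trigPoly N).smul_mem c (hH j))
  have hi1 : ∀ i, IntervalIntegrable (fun x => (α i : ℂ) * F (n + i) x) volume 0 (2 * Real.pi) :=
    fun i => (intervalIntegrable_of_mem_trigPoly (hF _)).const_mul _
  have hi2 : ∀ i, IntervalIntegrable
      (fun x => (γ i : ℂ) * deriv (fun y => a * G (n + i) y + c * H (n + i) y) x) volume 0
      (2 * Real.pi) :=
    fun i => (intervalIntegrable_deriv_of_mem_trigPoly (hmem _)).const_mul _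
  have hs : ∀ {ι : Type} (s : Finset ι) (f : ι → ℝ → ℂ),
      (∀ i ∈ s, IntervalIntegrable (f i) volume 0 (2 * Real.pi)) →
      IntervalIntegrable (fun x => ∑ i ∈ s, f i x) volume 0 (2 * Real.pi) := fun s f hf => by
    have e : (fun x => ∑ i ∈ s, f i x) = ∑ i ∈ s, f i := funext fun x => by simp
    rw [e]
    exact IntervalIntegrable.sum s hf
  rw [coeff_add (hs _ _ fun i _ => hi1 i) ((hs _ _ fun i _ => hi2 i).const_mul _),
    coeff_const_mul, coeff_sum _ fun i _ => hi1 i, coeff_sum _ fun i _ => hi2 i]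
  have hc : ∀ i, coeff (deriv fun y => a * G (n + i) y + c * H (n + i) y) k
      = Complex.I * k * (a * coeff (G (n + i)) k + c * coeff (H (n + i)) k) := fun i => by
    rw [coeff_deriv_of_mem_trigPoly (hmem _),
      coeff_add ((intervalIntegrable_of_mem_trigPoly (hG _)).const_mul _)
        ((intervalIntegrable_of_mem_trigPoly (hH _)).const_mul _), coeff_const_mul, coeff_const_mul]
  congr 1
  · exact sum_congr rfl fun i _ => coeff_const_mul _ _ _
  · congr 1
    have e : ∀ i ∈ range l,
        coeff (fun x => (γ i : ℂ) * deriv (fun y => a * G (n + i) y + c * H (n + i) y) x) k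
        = k * Complex.I * (a * ((γ i : ℂ) * coeff (G (n + i)) k)
          + c * ((γ i : ℂ) * coeff (H (n + i)) k)) := fun i _ => by
      rw [coeff_const_mul]
      rw [hc i]
      ring
    rw [sum_congr rfl e, ← mul_sum, sum_add_distrib, ← mul_sum, ← mul_sum]

/-- The scheme for the Fourier coefficients of the discrete solution. -/
theorem IsDiscreteSolution.coeff_step {q N : ℕ} {b ε T₀ Δt : ℝ} {u w : ℝ → ℝ → ℂ}
    {U W : ℕ → ℝ → ℂ} (h : IsDiscreteSolution q N b ε T₀ Δt u w U W) (n : ℕ) (k : ℤ) :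
    ∑ i ∈ range (q + 1), (bdfAlpha q i : ℂ) * coeff (U (n + i)) k
      + (Δt * k : ℝ) * Complex.I * (b * ∑ i ∈ range q, (bdfGamma q i : ℂ) * coeff (U (n + i)) k
        + ∑ i ∈ range q, (bdfGamma q i : ℂ) * coeff (W (n + i)) k) = 0 ∧
    ∑ i ∈ range (q + 1), (bdfAlpha q i : ℂ) * coeff (W (n + i)) k
      + (Δt * k : ℝ) * Complex.I *
        ((1 - (b : ℂ) ^ 2) * ∑ i ∈ range q, (bdfGamma q i : ℂ) * coeff (U (n + i)) k
        - b * ∑ i ∈ range q, (bdfGamma q i : ℂ) * coeff (W (n + i)) k)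
      + (bdfBeta q * Δt / ε : ℝ) * coeff (W (n + q)) k = 0 := by
  constructor
  · have h1 := coeff_bdf_step (m := q + 1) (l := q) (bdfAlpha q) (bdfGamma q) b 1 Δt h.mem_U h.mem_U
      h.mem_W n k
    have e : (fun x => ∑ i ∈ range (q + 1), (bdfAlpha q i : ℂ) * U (n + i) x
        + (Δt : ℂ) * ∑ i ∈ range q, (bdfGamma q i : ℂ)
          * deriv (fun y => (b : ℂ) * U (n + i) y + 1 * W (n + i) y) x) = fun x => 0 := by
      funext x
      simp only [one_mul]
      exact h.step_U n x
    have e0 : coeff (fun _ => 0) k = 0 := by simp [coeff_eq_integral]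
    rw [e, e0] at h1
    rw [h1]
    push_cast
    ring
  · have h1 := coeff_bdf_step (m := q + 1) (l := q) (bdfAlpha q) (bdfGamma q) (1 - (b : ℂ) ^ 2) (-b)
      Δt h.mem_W h.mem_U h.mem_W n k
    have e : (fun x => ∑ i ∈ range (q + 1), (bdfAlpha q i : ℂ) * W (n + i) x
        + (Δt : ℂ) * ∑ i ∈ range q, (bdfGamma q i : ℂ)
          * deriv (fun y => (1 - (b : ℂ) ^ 2) * U (n + i) y + (-b) * W (n + i) y) x)
        = fun x => -((bdfBeta q * Δt / ε : ℝ) : ℂ) * W (n + q) x := by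
      funext x
      simp only [neg_mul, ← sub_eq_add_neg]
      rw [← neg_mul]
      exact h.step_W n x
    rw [e, coeff_const_mul] at h1
    push_cast at h1 ⊢
    linear_combination -h1

/-! ### Norms -/

theorem l2Norm_sq {f : ℝ → ℂ} (hf : MemL2 f) :
    l2Norm f ^ 2 = ENNReal.ofReal (2 * Real.pi) * ∑' k : ℤ, ENNReal.ofReal (‖coeff f k‖ ^ 2) := by
  have hs := hasSum_sq_fourierCoeffOn Real.two_pi_pos hf
  have h1 : l2Norm f ^ 2 = ENNReal.ofReal (∫ x in (0 : ℝ)..(2 * Real.pi), ‖f x‖ ^ 2) := by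
    rw [intervalIntegral.integral_of_le Real.two_pi_pos.le,
      ofReal_integral_eq_lintegral_ofReal (hf.integrable_norm_pow (by norm_num))
        (ae_of_all _ fun x => by positivity)]
    have := eLpNorm_nnreal_pow_eq_lintegral (p := 2) (f := f)
      (μ := volume.restrict (Set.Ioc 0 (2 * Real.pi))) (by norm_num)
    unfold l2Norm
    norm_num at this
    rw [this]
    refine lintegral_congr fun x => ?_
    rw [ENNReal.ofReal_pow (norm_nonneg _), ofReal_norm]
  rw [h1]
  simp only [coeff]
  rw [← ENNReal.ofReal_tsum_of_nonneg (fun k => by positivity) hs.summable, hs.tsum_eq,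
    ← ENNReal.ofReal_mul Real.two_pi_pos.le, sub_zero, smul_eq_mul,
    mul_inv_cancel_left₀ Real.two_pi_pos.ne']

theorem sobolevNorm_sq (s : ℕ) (c : ℤ → ℂ) :
    sobolevNorm s c ^ 2 = ENNReal.ofReal (2 * Real.pi) *
      ∑' k : ℤ, ENNReal.ofReal ((1 + (k : ℝ) ^ 2) ^ s * ‖c k‖ ^ 2) := by
  rw [sobolevNorm, ← ENNReal.rpow_natCast, ← ENNReal.rpow_mul]
  norm_num

theorem tsum_ofReal_add {f g : ℤ → ℝ} (hf : ∀ k, 0 ≤ f k) (hg : ∀ k, 0 ≤ g k) (c : ℝ≥0∞) :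
    c * ∑' k, ENNReal.ofReal (f k + g k)
      = c * ∑' k, ENNReal.ofReal (f k) + c * ∑' k, ENNReal.ofReal (g k) := by
  rw [← mul_add, ← ENNReal.tsum_add]
  simp only [fun k => ENNReal.ofReal_add (hf k) (hg k)]

theorem sobolevNorm_sq_add (s : ℕ) (c d : ℤ → ℂ) :
    sobolevNorm s c ^ 2 + sobolevNorm s d ^ 2 = ENNReal.ofReal (2 * Real.pi) *
      ∑' k : ℤ, ENNReal.ofReal ((1 + (k : ℝ) ^ 2) ^ s * (‖c k‖ ^ 2 + ‖d k‖ ^ 2)) := by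
  simp only [mul_add]
  rw [tsum_ofReal_add (fun k => by positivity) (fun k => by positivity), sobolevNorm_sq,
    sobolevNorm_sq]

theorem memL2_of_mem_trigPoly {N : ℕ} {f : ℝ → ℂ} (hf : f ∈ trigPoly N) : MemL2 f := by
  have hc := (contDiff_of_mem_trigPoly hf).continuous
  obtain ⟨C, hC⟩ := (isCompact_Icc (a := (0 : ℝ)) (b := 2 * Real.pi)).exists_bound_of_continuousOn
    hc.continuousOn
  refine MemLp.of_bound hc.aestronglyMeasurable C ?_
  filter_upwards [ae_restrict_mem measurableSet_Ioc] with x hx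
  exact hC x (Set.Ioc_subset_Icc_self hx)

end

section

open Finset ComplexConjugate MeasureTheory

/-! ### The error estimate -/

/-- Bounds on the time derivatives after `T₀`, uniform in `ε`. -/
theorem exists_regularity_bound (p : ℕ) {b : ℝ} (hb : |b| < 1) (K : ℝ≥0) :
    ∃ C K' : ℝ, 0 < C ∧ 0 ≤ K' ∧ ∀ (ε T₀ : ℝ) (u w : ℝ → ℝ → ℂ), 0 < ε → 0 ≤ T₀ →
      IsWeakSolution b ε u w → (Case1 (p + 1) K u w ∨ Case2 (p + 1) K ε T₀ u w) →
      ∃ Y : ℤ → ℝ, (∀ k, 0 ≤ Y k) ∧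
        ENNReal.ofReal (2 * Real.pi) * ∑' k, ENNReal.ofReal (Y k) ≤ ENNReal.ofReal K' ∧
        ∀ k t, T₀ ≤ t →
          ‖(modeDeriv b ε k (fun t => coeff (u t) k, fun t => coeff (w t) k) (p + 2)).1 t‖ ^ 2
          + ‖(modeDeriv b ε k (fun t => coeff (u t) k, fun t => coeff (w t) k) (p + 2)).2 t‖ ^ 2
            ≤ C * Y k ∧
          (k : ℝ) ^ 2 *
          (‖(modeDeriv b ε k (fun t => coeff (u t) k, fun t => coeff (w t) k) (p + 1)).1 t‖ ^ 2
          + ‖(modeDeriv b ε k (fun t => coeff (u t) k, fun t => coeff (w t) k) (p + 1)).2 t‖ ^ 2)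
            ≤ C * Y k := by
  obtain ⟨A, hA, hlayer⟩ := exists_layer_bound p hb
  have hs : 0 < 1 - b ^ 2 := by linarith [(sq_lt_one_iff_abs_lt_one b).2 hb]
  set c := 1 / (1 - b ^ 2) with hc
  have hcpos : 0 < c := by positivity
  -- One pair of constants for both cases. Case 1 bounds unsquared norms, giving `2 K²` for each of
  -- its two conditions. Case 2 bounds squared norms by `K` and needs the extra layer factor `A`.
  refine ⟨c + c * A, 4 * (K : ℝ) ^ 2 + K, by positivity, by positivity, ?_⟩
  intro ε T₀ u w hε hT₀ hsol hcase
  set v : ℤ → (ℝ → ℂ) × (ℝ → ℂ) := fun k => (fun t => coeff (u t) k, fun t => coeff (w t) k) with hv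
  have hmode : ∀ k, IsMode b ε k (v k) := hsol.isMode
  rcases hcase with ⟨h1, h2⟩ | ⟨h1, h2⟩
  · set Y1 : ℤ → ℝ := fun k => (1 + (k : ℝ) ^ 2) ^ 1
      * (‖timeDerivCoeff (p + 2) u 0 k‖ ^ 2 + ‖timeDerivCoeff (p + 2) w 0 k‖ ^ 2) with hY1
    set Y2 : ℤ → ℝ := fun k => (1 + (k : ℝ) ^ 2) ^ 2
      * (‖timeDerivCoeff (p + 1) u 0 k‖ ^ 2 + ‖timeDerivCoeff (p + 1) w 0 k‖ ^ 2) with hY2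
    have hY1n : ∀ k, 0 ≤ Y1 k := fun k => by simp only [hY1]; positivity
    have hY2n : ∀ k, 0 ≤ Y2 k := fun k => by simp only [hY2]; positivity
    refine ⟨fun k => Y1 k + Y2 k, fun k => add_nonneg (hY1n k) (hY2n k), ?_, fun k t ht => ?_⟩
    · rw [tsum_ofReal_add hY1n hY2n, ← sobolevNorm_sq_add, ← sobolevNorm_sq_add]
      have hle : ∀ x y : ℝ≥0∞, x + y ≤ K → x ^ 2 + y ^ 2 ≤ 2 * (K : ℝ≥0∞) ^ 2 := fun x y hxy => by
        rw [two_mul]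
        exact add_le_add (pow_le_pow_left' (le_self_add.trans hxy) 2)
          (pow_le_pow_left' (le_add_self.trans hxy) 2)
      refine (add_le_add (hle _ _ h1) (hle _ _ h2)).trans ?_
      rw [ENNReal.ofReal_add (by positivity) (by positivity), ENNReal.ofReal_mul (by norm_num),
        ENNReal.ofReal_pow (by positivity), ENNReal.ofReal_coe_nnreal]
      refine le_trans (le_of_eq ?_) le_self_add
      norm_num
      ring
    · have ht0 : 0 ≤ t := hT₀.trans ht
      have e1 := ((hmode k).modeDeriv (p + 2)).norm_sq_le hb hε le_rfl ht0
      have e2 := ((hmode k).modeDeriv (p + 1)).norm_sq_le hb hε le_rfl ht0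
      have d1 := hsol.timeDerivCoeff_eq (p + 2) le_rfl k
      have d2 := hsol.timeDerivCoeff_eq (p + 1) le_rfl k
      rw [← d1.1, ← d1.2, ← hc] at e1
      rw [← d2.1, ← d2.2, ← hc] at e2
      set n1 := ‖timeDerivCoeff (p + 2) u 0 k‖ ^ 2 + ‖timeDerivCoeff (p + 2) w 0 k‖ ^ 2
      set n2 := ‖timeDerivCoeff (p + 1) u 0 k‖ ^ 2 + ‖timeDerivCoeff (p + 1) w 0 k‖ ^ 2
      have hn1 : 0 ≤ n1 := by positivity
      have hn2 : 0 ≤ n2 := by positivity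
      have hk := sq_nonneg (k : ℝ)
      have g1 : n1 ≤ Y1 k := le_mul_of_one_le_left hn1 (by rw [pow_one]; linarith)
      have g2 : (k : ℝ) ^ 2 * n2 ≤ Y2 k :=
        mul_le_mul_of_nonneg_right (by nlinarith) hn2
      have hY := add_nonneg (hY1n k) (hY2n k)
      have hAY : 0 ≤ c * A * (Y1 k + Y2 k) := by positivity
      constructor
      · calc _ ≤ c * n1 := e1
          _ ≤ c * (Y1 k + Y2 k) := mul_le_mul_of_nonneg_left (by linarith [hY2n k]) hcpos.le
          _ ≤ _ := by linarith
      · calc _ ≤ (k : ℝ) ^ 2 * (c * n2) := mul_le_mul_of_nonneg_left e2 hk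
          _ = c * ((k : ℝ) ^ 2 * n2) := by ring
          _ ≤ c * (Y1 k + Y2 k) := mul_le_mul_of_nonneg_left (by linarith [hY1n k]) hcpos.le
          _ ≤ _ := by linarith
  · refine ⟨fun k => (1 + (k : ℝ) ^ 2) ^ (p + 1 + 2)
      * (‖coeff (u 0) k‖ ^ 2 + ‖coeff (w 0) k‖ ^ 2), fun k => by positivity, ?_, fun k t ht => ?_⟩
    · rw [← sobolevNorm_sq_add]
      refine h1.trans ?_
      rw [ENNReal.ofReal_add (by positivity) (by positivity), ENNReal.ofReal_coe_nnreal]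
      exact le_add_self
    · have hT : ((p : ℝ) + 3) * ε * Real.log (1 / ε) ≤ T₀ := by
        refine le_trans (le_of_eq ?_) h2
        push_cast
        ring
      -- The energy estimate now starts at `T₀`, where the layer bound supplies the data.
      have e1 := ((hmode k).modeDeriv (p + 2)).norm_sq_le hb hε hT₀ ht
      have e2 := ((hmode k).modeDeriv (p + 1)).norm_sq_le hb hε hT₀ ht
      have l1 := hlayer ε T₀ k (v k) hε hT₀ hT (hmode k) (p + 2) le_rfl
      have l2 := hlayer ε T₀ k (v k) hε hT₀ hT (hmode k) (p + 1) (by omega)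
      rw [← hc] at e1 e2
      set n := ‖coeff (u 0) k‖ ^ 2 + ‖coeff (w 0) k‖ ^ 2
      have hn : 0 ≤ n := by positivity
      have hk := sq_nonneg (k : ℝ)
      have hone : (1 : ℝ) ≤ 1 + (k : ℝ) ^ 2 := by linarith
      have g1 : (1 + (k : ℝ) ^ 2) ^ (p + 2) * n ≤ (1 + (k : ℝ) ^ 2) ^ (p + 1 + 2) * n :=
        mul_le_mul_of_nonneg_right (pow_le_pow_right₀ hone (by omega)) hn
      have g2 : (k : ℝ) ^ 2 * (1 + (k : ℝ) ^ 2) ^ (p + 1) * n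
          ≤ (1 + (k : ℝ) ^ 2) ^ (p + 1 + 2) * n := by
        refine le_trans (mul_le_mul_of_nonneg_right ?_ hn) g1
        rw [pow_succ' _ (p + 1)]
        exact mul_le_mul_of_nonneg_right (by linarith) (by positivity)
      have hY : 0 ≤ c * ((1 + (k : ℝ) ^ 2) ^ (p + 1 + 2) * n) := by positivity
      have hcA : 0 ≤ c * A := by positivity
      constructor
      · calc _ ≤ c * (A * (1 + (k : ℝ) ^ 2) ^ (p + 2) * n) :=
              e1.trans (mul_le_mul_of_nonneg_left l1 hcpos.le)
          _ = c * A * ((1 + (k : ℝ) ^ 2) ^ (p + 2) * n) := by ring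
          _ ≤ c * A * ((1 + (k : ℝ) ^ 2) ^ (p + 1 + 2) * n) := mul_le_mul_of_nonneg_left g1 hcA
          _ ≤ _ := by linarith
      · calc _ ≤ (k : ℝ) ^ 2 * (c * (A * (1 + (k : ℝ) ^ 2) ^ (p + 1) * n)) :=
              mul_le_mul_of_nonneg_left (e2.trans (mul_le_mul_of_nonneg_left l2 hcpos.le)) hk
          _ = c * A * ((k : ℝ) ^ 2 * (1 + (k : ℝ) ^ 2) ^ (p + 1) * n) := by ring
          _ ≤ c * A * ((1 + (k : ℝ) ^ 2) ^ (p + 1 + 2) * n) := mul_le_mul_of_nonneg_left g2 hcA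
          _ ≤ _ := by linarith

/-- The error of the scheme in a resolved Fourier mode. -/
theorem exists_mode_error_bound {p : ℕ} (hp : p ≤ 3) {b c₁ : ℝ} (hb : |b| < 1) (hc₁ : 0 ≤ c₁)
    (T : ℝ) :
    ∃ C : ℝ, 0 < C ∧ ∀ (ε T₀ Δt : ℝ) (N : ℕ) (u w : ℝ → ℝ → ℂ) (U W : ℕ → ℝ → ℂ) (k : ℤ) (B : ℝ),
      0 < ε → 0 ≤ T₀ → 0 < Δt → Δt ≤ 1 → |Δt * k| ≤ c₁ → (Δt * k) ^ 2 ≤ c₁ * Δt →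
      IsWeakSolution b ε u w → IsDiscreteSolution (p + 1) N b ε T₀ Δt u w U W →
      k ∈ Set.Icc (-(N : ℤ)) N → 0 ≤ B →
      (∀ t, T₀ ≤ t →
          ‖(modeDeriv b ε k (fun t => coeff (u t) k, fun t => coeff (w t) k) (p + 2)).1 t‖ ^ 2
          + ‖(modeDeriv b ε k (fun t => coeff (u t) k, fun t => coeff (w t) k) (p + 2)).2 t‖ ^ 2
            ≤ B ∧
          (k : ℝ) ^ 2 *
          (‖(modeDeriv b ε k (fun t => coeff (u t) k, fun t => coeff (w t) k) (p + 1)).1 t‖ ^ 2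
          + ‖(modeDeriv b ε k (fun t => coeff (u t) k, fun t => coeff (w t) k) (p + 1)).2 t‖ ^ 2)
            ≤ B) →
      ∀ n : ℕ, n * Δt ≤ T →
        ‖coeff (u (T₀ + n * Δt)) k - coeff (U n) k‖ ^ 2
          + ‖coeff (w (T₀ + n * Δt)) k - coeff (W n) k‖ ^ 2 ≤ C * (Δt ^ (2 * (p + 1)) * B) := by
  obtain ⟨S, hS, hstab⟩ := exists_stability hp hb hc₁ T
  obtain ⟨A, hA, hcons⟩ := exists_mode_consistency hp hb
  refine ⟨S * A ^ 2 + 1, by positivity, ?_⟩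
  intro ε T₀ Δt N u w U W k B hε hT₀ hΔ hΔ1 hκ hκ2 hsol hdis hk hB hreg n hn
  have hβ := bdfBeta_pos p
  set v : (ℝ → ℂ) × (ℝ → ℂ) := (fun t => coeff (u t) k, fun t => coeff (w t) k) with hv
  have hsq : ∀ x : ℝ, x ^ 2 ≤ B → x ≤ Real.sqrt B := fun x hx => Real.le_sqrt_of_sq_le hx
  have hc : ∀ m : ℕ, _ := fun m => hcons ε k v (hsol.isMode k) (T₀ + m * Δt) (Real.sqrt B) Δt
    (by positivity) hΔ
    (fun t ht => hsq _ (by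
      have h1 := (hreg t (le_trans (le_add_of_nonneg_right (by positivity)) ht)).1
      linarith [sq_nonneg ‖(modeDeriv b ε k v (p + 2)).2 t‖]))
    (fun t ht => hsq _ (by
      have h1 := (hreg t (le_trans (le_add_of_nonneg_right (by positivity)) ht)).1
      linarith [sq_nonneg ‖(modeDeriv b ε k v (p + 2)).1 t‖]))
    (fun t ht => hsq _ (by
      have h1 := (hreg t (le_trans (le_add_of_nonneg_right (by positivity)) ht)).2
      rw [mul_pow, sq_abs]
      have : 0 ≤ (k : ℝ) ^ 2 * ‖(modeDeriv b ε k v (p + 1)).2 t‖ ^ 2 := by positivity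
      linarith))
    (fun t ht => hsq _ (by
      have h1 := (hreg t (le_trans (le_add_of_nonneg_right (by positivity)) ht)).2
      rw [mul_pow, sq_abs]
      have : 0 ≤ (k : ℝ) ^ 2 * ‖(modeDeriv b ε k v (p + 1)).1 t‖ ^ 2 := by positivity
      linarith))
  have htime : ∀ m i : ℕ, T₀ + ((m + i : ℕ) : ℝ) * Δt = T₀ + m * Δt + i * Δt := fun m i => by
    push_cast
    ring
  have hlast : ((p + 1 : ℕ) : ℝ) = p + 1 := by push_cast; rfl
  -- The error solves the scheme with the consistency defect as forcing, and its starting values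
  -- vanish because the scheme starts from projections and `k` is resolved. The factor `Δt^(p+2)` in
  -- the defect becomes `Δt^(2(p+1))` after squaring and dividing by `Δt²`.
  have h := hstab Δt (Δt * k) (bdfBeta (p + 1) * Δt / ε) (A * (Δt ^ (p + 2) * Real.sqrt B))
    (fun m => v.1 (T₀ + m * Δt) - coeff (U m) k) (fun m => v.2 (T₀ + m * Δt) - coeff (W m) k)
    hΔ hΔ1 hκ hκ2 (by positivity)
    (fun i hi => by
      rw [hdis.start_U i (by omega), coeff_proj N _ hk]
      simp [hv])
    (fun i hi => by
      rw [hdis.start_W i (by omega), coeff_proj N _ hk]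
      simp [hv])
    (fun m => by
      refine le_trans (le_of_eq ?_) (hc m).1
      congr 1
      simp only [mul_sub, sum_sub_distrib, htime]
      linear_combination -(hdis.coeff_step m k).1)
    (fun m => by
      refine le_trans (le_of_eq ?_) (hc m).2
      congr 1
      simp only [mul_sub, sum_sub_distrib, htime, hlast]
      linear_combination -(hdis.coeff_step m k).2) n hn
  refine h.trans ?_
  have e : (A * (Δt ^ (p + 2) * Real.sqrt B)) ^ 2 / Δt ^ 2 = A ^ 2 * (Δt ^ (2 * (p + 1)) * B) := by
    rw [mul_pow, mul_pow, Real.sq_sqrt hB]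
    field_simp
    ring
  rw [e]
  have : 0 ≤ Δt ^ (2 * (p + 1)) * B := by positivity
  linarith

/-- The unresolved Fourier modes. -/
theorem tail_bound {b ε : ℝ} (hb : |b| < 1) (hε : 0 < ε) {u w : ℝ → ℝ → ℂ}
    (hsol : IsWeakSolution b ε u w) {T₀ t : ℝ} (hT₀ : 0 ≤ T₀) (ht : T₀ ≤ t) {N : ℕ} (hN : 1 ≤ N)
    {k : ℤ} (hk : k ∉ Set.Icc (-(N : ℤ)) N) (q : ℕ) :
    ‖coeff (u t) k‖ ^ 2 + ‖coeff (w t) k‖ ^ 2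
      ≤ 1 / (1 - b ^ 2) * (1 / (N : ℝ) ^ (4 * q) * ((1 + (k : ℝ) ^ 2) ^ (2 * q + 1)
        * (‖coeff (u T₀) k‖ ^ 2 + ‖coeff (w T₀) k‖ ^ 2))) := by
  have hs : 0 < 1 - b ^ 2 := by linarith [(sq_lt_one_iff_abs_lt_one b).2 hb]
  refine ((hsol.isMode k).norm_sq_le hb hε hT₀ ht).trans ?_
  refine mul_le_mul_of_nonneg_left ?_ (by positivity)
  rw [← mul_assoc]
  refine le_mul_of_one_le_left (by positivity) ?_
  have hNpos : (0 : ℝ) < N := by exact_mod_cast hN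
  rw [one_div, ← div_eq_inv_mul, one_le_div (by positivity)]
  have hkN : (N : ℝ) ≤ |(k : ℝ)| := by
    have : (N : ℤ) ≤ |k| := by
      rw [Set.mem_Icc, ← abs_le] at hk
      omega
    exact_mod_cast this
  have h1 : (N : ℝ) ^ 2 ≤ 1 + (k : ℝ) ^ 2 := by
    rw [← sq_abs (k : ℝ)]
    nlinarith
  calc (N : ℝ) ^ (4 * q) = ((N : ℝ) ^ 2) ^ (2 * q) := by rw [← pow_mul]; ring_nf
    _ ≤ (1 + (k : ℝ) ^ 2) ^ (2 * q) := by gcongr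
    _ ≤ _ := pow_le_pow_right₀ (by linarith [sq_nonneg (k : ℝ)]) (by omega)

end

end IMEXBDF

/-! ### Assembly of the error estimate -/

theorem mainTheorem5 (q : ℕ) (hq : 1 ≤ q) (hq4 : q ≤ 4) (b : ℝ) (hb : |b| < 1)
    (cCFL : ℝ) (hc : 0 < cCFL) (T : ℝ) (K : ℝ≥0) :
    ∃ C : ℝ, 0 < C ∧
      ∀ (ε : ℝ), 0 < ε →
      ∀ (N : ℕ), 1 ≤ N →
      ∀ (Δt : ℝ), 0 < Δt → Δt ≤ min (cCFL / (N : ℝ) ^ 2) 1 →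
      ∀ (T₀ : ℝ), 0 ≤ T₀ →
      ∀ (u w : ℝ → ℝ → ℂ), IMEXBDF.IsWeakSolution b ε u w →
        (IMEXBDF.Case1 q K u w ∨ IMEXBDF.Case2 q K ε T₀ u w) →
        IMEXBDF.ExtraRegularity q K T₀ u w →
      ∀ (U W : ℕ → ℝ → ℂ), IMEXBDF.IsDiscreteSolution q N b ε T₀ Δt u w U W →
      ∀ (n : ℕ), T₀ + n * Δt ≤ T →
        IMEXBDF.l2Norm (u (T₀ + n * Δt) - U n) ^ 2
            + IMEXBDF.l2Norm (w (T₀ + n * Δt) - W n) ^ 2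
          ≤ ENNReal.ofReal (C * (Δt ^ (2 * q) + 1 / (N : ℝ) ^ (4 * q))) := by
  open IMEXBDF in
  obtain ⟨p, rfl⟩ : ∃ p, q = p + 1 := ⟨q - 1, by omega⟩
  have hp : p ≤ 3 := by omega
  obtain ⟨A, K', hA, hK', hreg⟩ := exists_regularity_bound p hb K
  obtain ⟨E, hE, herr⟩ := exists_mode_error_bound hp hb hc.le T
  have hs : 0 < 1 - b ^ 2 := by linarith [(sq_lt_one_iff_abs_lt_one b).2 hb]
  set c := 1 / (1 - b ^ 2) with hcdef
  have hcpos : 0 < c := by positivity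
  -- `E * A` serves the resolved modes and `c` the tail. The summand 1 keeps the constant positive
  -- when `K = 0`.
  refine ⟨(E * A + c) * (K' + K + 1), by positivity, ?_⟩
  intro ε hε N hN Δt hΔ hCFL T₀ hT₀ u w hsol hcase hextra U W hdis n hn
  obtain ⟨Y, hY, hYsum, hYb⟩ := hreg ε T₀ u w hε hT₀ hsol hcase
  set X : ℤ → ℝ := fun k => (1 + (k : ℝ) ^ 2) ^ (2 * (p + 1) + 1)
    * (‖coeff (u T₀) k‖ ^ 2 + ‖coeff (w T₀) k‖ ^ 2) with hX
  have hX0 : ∀ k, 0 ≤ X k := fun k => by simp only [hX]; positivity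
  have hXsum : ENNReal.ofReal (2 * Real.pi) * ∑' k, ENNReal.ofReal (X k) ≤ K := by
    rw [← sobolevNorm_sq_add]
    exact hextra.1
  have hNpos : (0 : ℝ) < N := by exact_mod_cast hN
  have hN1 : (1 : ℝ) ≤ N := by exact_mod_cast hN
  have hCFL1 : Δt * (N : ℝ) ^ 2 ≤ cCFL := by
    rw [← le_div_iff₀ (by positivity)]
    exact hCFL.trans (min_le_left _ _)
  have hΔ1 : Δt ≤ 1 := hCFL.trans (min_le_right _ _)
  set t := T₀ + n * Δt with ht
  have hnΔ : 0 ≤ (n : ℝ) * Δt := by positivity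
  have hTt : T₀ ≤ t := by linarith
  set θ := Δt ^ (2 * (p + 1)) + 1 / (N : ℝ) ^ (4 * (p + 1)) with hθ
  have hθ1 : Δt ^ (2 * (p + 1)) ≤ θ := le_add_of_nonneg_right (by positivity)
  have hθ2 : 1 / (N : ℝ) ^ (4 * (p + 1)) ≤ θ := le_add_of_nonneg_left (by positivity)
  have hθ0 : 0 ≤ θ := by positivity
  have hmu := hsol.memL2_u t (hT₀.trans hTt)
  have hmw := hsol.memL2_w t (hT₀.trans hTt)
  have hmU := memL2_of_mem_trigPoly (hdis.mem_U n)
  have hmW := memL2_of_mem_trigPoly (hdis.mem_W n)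
  have hcu : ∀ k, coeff (u t - U n) k = coeff (u t) k - coeff (U n) k :=
    coeff_sub hmu.intervalIntegrable hmU.intervalIntegrable
  have hcw : ∀ k, coeff (w t - W n) k = coeff (w t) k - coeff (W n) k :=
    coeff_sub hmw.intervalIntegrable hmW.intervalIntegrable
  have hmode : ∀ k, ‖coeff (u t - U n) k‖ ^ 2 + ‖coeff (w t - W n) k‖ ^ 2
      ≤ (E * A + c) * θ * (Y k + X k) := by
    intro k
    have hYk := hY k
    have hXk := hX0 k
    rw [hcu, hcw]
    by_cases hk : k ∈ Set.Icc (-(N : ℤ)) N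
    · have hkN : |(k : ℝ)| ≤ N := by
        rw [Set.mem_Icc, ← abs_le] at hk
        exact_mod_cast hk
      have hκ : |Δt * k| ≤ cCFL := by
        rw [abs_mul, abs_of_pos hΔ]
        refine le_trans (mul_le_mul_of_nonneg_left (hkN.trans ?_) hΔ.le) hCFL1
        nlinarith
      -- The quadratic CFL condition enters here: `Δt k² ≤ Δt N² ≤ cCFL`.
      have hκ2 : (Δt * k) ^ 2 ≤ cCFL * Δt := by
        have : (k : ℝ) ^ 2 ≤ (N : ℝ) ^ 2 := by
          rw [← sq_abs (k : ℝ)]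
          gcongr
        calc (Δt * k) ^ 2 = Δt * (k : ℝ) ^ 2 * Δt := by ring
          _ ≤ Δt * (N : ℝ) ^ 2 * Δt := by gcongr
          _ ≤ _ := by gcongr
      have h1 := herr ε T₀ Δt N u w U W k (A * Y k) hε hT₀ hΔ hΔ1 hκ hκ2 hsol hdis hk
        (by positivity) (fun s hs => hYb k s hs) n (by linarith)
      calc _ ≤ E * (Δt ^ (2 * (p + 1)) * (A * Y k)) := h1
        _ ≤ E * (θ * (A * Y k)) := by gcongr
        _ = E * A * θ * Y k := by ring
        _ ≤ (E * A + c) * θ * (Y k + X k) := by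
          gcongr
          · linarith
          · linarith
    · rw [coeff_eq_zero_of_mem_trigPoly (hdis.mem_U n) hk,
        coeff_eq_zero_of_mem_trigPoly (hdis.mem_W n) hk, sub_zero, sub_zero]
      have h1 := tail_bound hb hε hsol hT₀ hTt hN hk (p + 1)
      calc _ ≤ c * (1 / (N : ℝ) ^ (4 * (p + 1)) * X k) := h1
        _ ≤ c * (θ * X k) := by gcongr
        _ = c * θ * X k := by ring
        _ ≤ (E * A + c) * θ * (Y k + X k) := by
          have : 0 ≤ E * A := by positivity
          gcongr
          · linarith
          · linarith
  rw [l2Norm_sq (hmu.sub hmU), l2Norm_sq (hmw.sub hmW),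
    ← tsum_ofReal_add (fun k => by positivity) (fun k => by positivity)]
  have hcst : 0 ≤ (E * A + c) * θ := by positivity
  calc _ ≤ ENNReal.ofReal (2 * Real.pi)
        * ∑' k, ENNReal.ofReal ((E * A + c) * θ * (Y k + X k)) := by
        gcongr with k
        exact hmode k
    _ = ENNReal.ofReal ((E * A + c) * θ)
        * (ENNReal.ofReal (2 * Real.pi) * ∑' k, ENNReal.ofReal (Y k + X k)) := by
        simp only [ENNReal.ofReal_mul hcst]
        rw [ENNReal.tsum_mul_left, mul_left_comm]
    _ ≤ ENNReal.ofReal ((E * A + c) * θ) * ENNReal.ofReal (K' + K + 1) := by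
        gcongr
        rw [tsum_ofReal_add hY hX0]
        refine (add_le_add hYsum hXsum).trans ?_
        rw [← ENNReal.ofReal_coe_nnreal, ← ENNReal.ofReal_add hK' K.coe_nonneg]
        exact ENNReal.ofReal_le_ofReal (by linarith)
    _ = _ := by
        rw [← ENNReal.ofReal_mul hcst]
        congr 1
        ring
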